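/- Let $n\ge 1$. For $m\in\mathbb R$, $\rho>0$, $\delta\ge 0$ let $S^m_{\rho,\delta}(\mathbb R^n\times\mathbb R^n)$ be the set of $a\in C^\infty(\mathbb R^n\times\mathbb R^n,\mathbb C)$ such that for all multi-indices $\alpha,\gamma$ there is $C_{\alpha,\gamma}>0$ with $|\partial_x^\alpha\partial_\theta^\gamma a(x,\theta)|\le C_{\alpha,\gamma}(1+|\theta|)^{m-\rho|\gamma|+\delta|\alpha|}$ for all $x,\theta\in\mathbb R^n$. Write $\mathcal Fu(\theta)=\int e^{-iy\cdot\theta}u(y)\,dy$. A separated phase is a function $\varphi(x)\psi(\theta)$ with $\varphi,\psi\in C^\infty(\mathbb R^n,\mathbb R)$, $\psi(t\theta)=t\psi(\theta)$ for $t>0$, and $|\varphi(x)|\le C|x|$ for $|x|\le 1$, with some constant $C$. For such a phase and a symbol $a$ put $$(F u)(x)=\int_{\mathbb R^n}e^{i\varphi(x)\psi(\theta)}a(x,\theta)\,\mathcal Fu(\theta)\,d\theta,\qquad u\in\mathcal S(\mathbb R^n).$$ $F$ extends to a bounded operator on $L^2(\mathbb R^n)$ if there is a constant $C$ with $\|Fu\|_{L^2}\le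 C\|u\|_{L^2}$ for all $u\in\mathcal S(\mathbb R^n)$. (1) There exist a separated phase $\varphi(x)\psi(\theta)$ with $\varphi'(x)\ne 0$ for all $x$ and $\psi\not\equiv 0$, and a symbol $a\in\bigcap_{0<\rho<1}S^0_{\rho,1}(\mathbb R^n\times\mathbb R^n)$, such that $F$ does not extend to a bounded operator on $L^2(\mathbb R^n)$. (2) More precisely, there is a continuous function $b:[0,\infty)\to\mathbb R$, smooth on $(0,\infty)$, with $b(0)=0$, $b'(t)>0$ and $|b^{(k)}(t)|\le C_kt^{-k}$ for all $t>0$ and $k\ge 1$ (with constants $C_k>0$), for which the following holds. Let $\varphi(x)\psi(\theta)$ be any separated phase, let $K\in\mathcal S(\mathbb R)$ with $K=1$ on $[-\delta,\delta]$, where $0<\delta<1$, and let $\chi\in C_0^\infty(\mathbb R)$ with $\operatorname{supp}\chi\subset[-1,1]$ and $\chi=1$ on $[-\beta,\beta]$, where $0<\beta<1$ ($K$ and $\chi$ may be complex-valued). Put $$a(x,\theta)=e^{-i\varphi(x)\psi(\theta)}\prod_{j=1}^n\chi(x_j)\,K\big(b(|x|)\,|x|\,\theta_j\big),\qquad g(x)=b(|x|)\,|x|.$$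 Then $a\in\bigcap_{0<\rho<1}S^0_{\rho,1}(\mathbb R^n\times\mathbb R^n)$; on $]0,\beta[^n$ the function $g$ is continuous, nonnegative and strictly increasing in each variable, and $g(x)/|x|\to 0$ as $x\to 0$; for every $u\in\mathcal S(\mathbb R^n)$ and $x\in\,]0,\beta]^n$, $$(Fu)(x)=\int_{\mathbb R^n}u(g(x)z)\prod_{j=1}^n\mathcal FK(z_j)\,dz;$$ and $F$ does not extend to a bounded operator on $L^2(\mathbb R^n)$. -/

import Mathlib

open MeasureTheory Filter Topology Set
open scoped ContDiff SchwartzMap InnerProductSpace NNReal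

noncomputable section

/-- `ℝⁿ` with its Euclidean norm. -/
abbrev Rn (n : ℕ) : Type := EuclideanSpace ℝ (Fin n)

/-- `∂a/∂x_i` for a function `a(x, θ)`. -/
def partialX {n N : ℕ} (i : Fin n) (a : Rn n × Rn N → ℂ) : Rn n × Rn N → ℂ :=
  fun p => fderiv ℝ a p (EuclideanSpace.single i 1, 0)

/-- `∂a/∂θ_j` for a function `a(x, θ)`. -/
def partialTheta {n N : ℕ} (j : Fin N) (a : Rn n × Rn N → ℂ) : Rn n × Rn N → ℂ :=
  fun p => fderiv ℝ a p (0, EuclideanSpace.single j 1)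

/-- `∂_x^α a` for a multi-index `α ∈ ℕⁿ`. -/
def multiPartialX {n N : ℕ} (α : Fin n → ℕ) (a : Rn n × Rn N → ℂ) : Rn n × Rn N → ℂ :=
  (List.finRange n).foldr (fun i f => (partialX i)^[α i] f) a

/-- `∂_θ^γ a` for a multi-index `γ ∈ ℕᴺ`. -/
def multiPartialTheta {n N : ℕ} (γ : Fin N → ℕ) (a : Rn n × Rn N → ℂ) : Rn n × Rn N → ℂ :=
  (List.finRange N).foldr (fun j f => (partialTheta j)^[γ j] f) a

/-- The Hörmander class `S^m_{ρ,δ}(ℝⁿ × ℝᴺ)`: smooth functions `a(x, θ)` with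
`|∂_x^α ∂_θ^γ a(x, θ)| ≤ C_{α,γ} (1 + |θ|)^{m - ρ|γ| + δ|α|}` for all multi-indices. -/
def symbolClass (n N : ℕ) (m ρ δ : ℝ) : Set (Rn n × Rn N → ℂ) :=
  {a | ContDiff ℝ ∞ a ∧
    ∀ (α : Fin n → ℕ) (γ : Fin N → ℕ), ∃ C : ℝ, 0 < C ∧ ∀ (x : Rn n) (θ : Rn N),
      ‖multiPartialX α (multiPartialTheta γ a) (x, θ)‖ ≤
        C * (1 + ‖θ‖) ^ (m - ρ * ((∑ j, γ j : ℕ) : ℝ) + δ * ((∑ i, α i : ℕ) : ℝ))}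

/-- The Fourier transform `𝓕u(θ) = ∫ e^{-i y·θ} u(y) dy`. -/
def fourierT {V : Type*} [NormedAddCommGroup V] [InnerProductSpace ℝ V] [MeasurableSpace V]
    [BorelSpace V] [FiniteDimensional ℝ V] (u : V → ℂ) (θ : V) : ℂ :=
  ∫ y, Complex.exp (-(Complex.I * ((⟪y, θ⟫_ℝ : ℝ) : ℂ))) * u y

/-- The Fourier integral operator `(Fu)(x) = ∫ e^{iφ(x)ψ(θ)} a(x, θ) 𝓕u(θ) dθ`. -/
def fourierIntegralOp {n : ℕ} (φ ψ : Rn n → ℝ) (a : Rn n × Rn n → ℂ) (u : 𝓢(Rn n, ℂ)) :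
    Rn n → ℂ :=
  fun x => ∫ θ, Complex.exp (Complex.I * ((φ x * ψ θ : ℝ) : ℂ)) * a (x, θ) * fourierT u θ

/-- An operator given on Schwartz functions extends to a bounded operator on `L²(ℝⁿ)`:
`‖Au‖_{L²} ≤ C ‖u‖_{L²}` for all Schwartz functions `u`. -/
def ExtendsBoundedlyToL2 {n : ℕ} (A : 𝓢(Rn n, ℂ) → (Rn n → ℂ)) : Prop :=
  ∃ C : ℝ≥0, ∀ u : 𝓢(Rn n, ℂ), eLpNorm (A u) 2 volume ≤ C * eLpNorm (u : Rn n → ℂ) 2 volume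

/-- The conditions on the two factors of a separated phase `φ(x)ψ(θ)`. -/
structure IsSeparatedPhase {n : ℕ} (φ ψ : Rn n → ℝ) : Prop where
  smooth_left : ContDiff ℝ ∞ φ
  smooth_right : ContDiff ℝ ∞ ψ
  homogeneous : ∀ (t : ℝ) (θ : Rn n), 0 < t → ψ (t • θ) = t * ψ θ
  bound : ∃ C : ℝ, ∀ x : Rn n, ‖x‖ ≤ 1 → |φ x| ≤ C * ‖x‖

/-- Kumano-Go type functions on `[0, ∞)` (the values at negative arguments play no role). -/
structure IsKumanoGo (b : ℝ → ℝ) : Prop where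
  continuousOn : ContinuousOn b (Ici 0)
  smooth : ContDiffOn ℝ ∞ b (Ioi 0)
  zero : b 0 = 0
  deriv_pos : ∀ t : ℝ, 0 < t → 0 < deriv b t
  deriv_bound : ∀ k : ℕ, 1 ≤ k → ∃ C : ℝ, 0 < C ∧
    ∀ t : ℝ, 0 < t → |iteratedDeriv k b t| ≤ C * (t ^ k)⁻¹

/-- The symbol `e^{-iφ(x)ψ(θ)} ∏ⱼ χ(xⱼ) K(b(|x|)|x|θⱼ)`. -/
def kumanoGoSymbol {n : ℕ} (φ ψ : Rn n → ℝ) (χ K : ℝ → ℂ) (b : ℝ → ℝ) : Rn n × Rn n → ℂ :=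
  fun p => Complex.exp (-(Complex.I * ((φ p.1 * ψ p.2 : ℝ) : ℂ))) *
    ∏ j, (χ (p.1 j) * K (b ‖p.1‖ * ‖p.1‖ * p.2 j))

/-- A scale function on the cube `]0, β[ⁿ`: continuous, nonnegative, `g(x)/|x| → 0` as `x → 0`,
and increasing in each coordinate. -/
structure IsScale {n : ℕ} (β : ℝ) (g : Rn n → ℝ) : Prop where
  continuousOn : ContinuousOn g {x | ∀ i, x i ∈ Ioo 0 β}
  nonneg : ∀ x : Rn n, (∀ i, x i ∈ Ioo 0 β) → 0 ≤ g x
  tendsto : Tendsto (fun x => g x / ‖x‖) (𝓝[{x | ∀ i, x i ∈ Ioo 0 β}] 0) (𝓝 0)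
  increasing : ∀ (i : Fin n) (x y : Rn n), (∀ j, x j ∈ Ioo 0 β) → (∀ j, y j ∈ Ioo 0 β) →
    (∀ j, j ≠ i → x j = y j) → x i < y i → g x < g y

end

/-! Write g(x) = b(|x|)|x|. The phase factor in the symbol cancels the phase of the operator, so on
the cube ]0, β]ⁿ only the multiplier ∏ K(g(x)θⱼ) remains, and the multiplication formula for the
Fourier transform turns Fu(x) into an average of u at scale g(x). Since g(x) = o(|x|), the operator
sees u essentially at the origin only: for a bump at scale ε and any fixed M, |Fu| stays above a
positive constant on the whole cube of side Mε once ε is small. Comparing L² norms gives c²Mⁿ ≤ C²v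
for every M, which is absurd (`not_extendsBoundedlyToL2_kumanoGoSymbol`).

The symbol estimates need b to vanish at 0, but slowly. A smooth homogeneous ψ is linear
(`exists_clm_of_homogeneous`), so with |φ(x)| ≤ C|x| an x-derivative of the symbol costs 1 + |θ| and
a θ-derivative costs |x| + (1 + |θ|)⁻¹. The singularity of g at x = 0 is harmless, since K = 1 near
0: where the derivatives of K matter, |x|⁻¹ is at most a multiple of 1 + |θ|
(`hasSymBound_schwartz_scaled`). The rapid decay of K supplies arbitrary powers of (1 + g(x)|θ|)⁻¹.
For b(t) = arctan(log t) + π/2 one has b(t)(1 + |log t|) ≥ 1, so trading |x| for g(x) loses only a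
logarithm, and each θ-cost becomes O((1 + |θ|)^(-ρ)) for every ρ < 1 (`exists_add_inv_le_rpow`). -/

noncomputable section

/-! ### Calculus of derivative bounds with weights and costs. -/

section DerivBound

variable {D E F : Type*} [NormedAddCommGroup E] [NormedSpace ℝ E]
  [NormedCommRing F] [NormedAlgebra ℝ F]

/-- The function `f` is bounded on `Ω` by a multiple of the weight `W`, and the derivatives of `f`
up to order `k` along the directions `v d` are bounded by multiples of `W` times the product of
the corresponding costs `c d`. -/
def HasDerivBound (Ω : Set E) (v : D → E) (c : D → E → ℝ) : ℕ → (E → ℝ) → (E → F) → Prop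
  | 0, W, f => ∃ C : ℝ, 0 ≤ C ∧ ∀ p ∈ Ω, ‖f p‖ ≤ C * W p
  | k + 1, W, f => (∃ C : ℝ, 0 ≤ C ∧ ∀ p ∈ Ω, ‖f p‖ ≤ C * W p) ∧
      (∀ p ∈ Ω, DifferentiableAt ℝ f p) ∧
      ∀ d, HasDerivBound Ω v c k (fun p => c d p * W p) (fun p => fderiv ℝ f p (v d))

namespace HasDerivBound

variable {Ω Ω' : Set E} {v : D → E} {c : D → E → ℝ} {k : ℕ} {W W' : E → ℝ} {f g : E → F}

theorem bound (h : HasDerivBound Ω v c k W f) :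
    ∃ C : ℝ, 0 ≤ C ∧ ∀ p ∈ Ω, ‖f p‖ ≤ C * W p := by
  cases k with
  | zero => exact h
  | succ k => exact h.1

theorem of_succ (h : HasDerivBound Ω v c (k + 1) W f) : HasDerivBound Ω v c k W f := by
  induction k generalizing W f with
  | zero => exact h.1
  | succ k ih => exact ⟨h.1, h.2.1, fun d => ih (h.2.2 d)⟩

theorem congr (hΩ : IsOpen Ω) (hfg : EqOn f g Ω) (h : HasDerivBound Ω v c k W f) :
    HasDerivBound Ω v c k W g := by
  induction k generalizing W f g with
  | zero =>
    obtain ⟨C, hC, h⟩ := h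
    exact ⟨C, hC, fun p hp => hfg hp ▸ h p hp⟩
  | succ k ih =>
    obtain ⟨⟨C, hC, h⟩, hd, h'⟩ := h
    have hev : ∀ p ∈ Ω, f =ᶠ[𝓝 p] g := fun p hp => hfg.eventuallyEq_of_mem (hΩ.mem_nhds hp)
    refine ⟨⟨C, hC, fun p hp => hfg hp ▸ h p hp⟩,
      fun p hp => (hev p hp).differentiableAt_iff.1 (hd p hp), fun d => ih ?_ (h' d)⟩
    intro p hp
    simp only [(hev p hp).fderiv_eq]

theorem subset (hs : Ω ⊆ Ω') (h : HasDerivBound Ω' v c k W f) : HasDerivBound Ω v c k W f := by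
  induction k generalizing W f with
  | zero =>
    obtain ⟨C, hC, h⟩ := h
    exact ⟨C, hC, fun p hp => h p (hs hp)⟩
  | succ k ih =>
    obtain ⟨⟨C, hC, h⟩, hd, h'⟩ := h
    exact ⟨⟨C, hC, fun p hp => h p (hs hp)⟩, fun p hp => hd p (hs hp), fun d => ih (h' d)⟩

theorem mono (hc : ∀ d, ∀ p ∈ Ω, 0 ≤ c d p) {M : ℝ} (hM : 0 ≤ M)
    (hW : ∀ p ∈ Ω, W p ≤ M * W' p) (h : HasDerivBound Ω v c k W f) :
    HasDerivBound Ω v c k W' f := by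
  have key : ∀ (W W' : E → ℝ) (f : E → F), (∀ p ∈ Ω, W p ≤ M * W' p) →
      (∃ C : ℝ, 0 ≤ C ∧ ∀ p ∈ Ω, ‖f p‖ ≤ C * W p) →
      ∃ C : ℝ, 0 ≤ C ∧ ∀ p ∈ Ω, ‖f p‖ ≤ C * W' p := by
    rintro W W' f hW ⟨C, hC, h⟩
    refine ⟨C * M, by positivity, fun p hp => (h p hp).trans ?_⟩
    rw [mul_assoc]
    exact mul_le_mul_of_nonneg_left (hW p hp) hC
  induction k generalizing W W' f with
  | zero => exact key W W' f hW h
  | succ k ih =>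
    refine ⟨key W W' f hW h.1, h.2.1, fun d => ih (fun p hp => ?_) (h.2.2 d)⟩
    calc c d p * W p ≤ c d p * (M * W' p) := mul_le_mul_of_nonneg_left (hW p hp) (hc d p hp)
      _ = _ := by ring

theorem succ_of (hΩ : IsOpen Ω) {f' : E → E →L[ℝ] F}
    (hb : ∃ C : ℝ, 0 ≤ C ∧ ∀ p ∈ Ω, ‖f p‖ ≤ C * W p) (hf : ∀ p ∈ Ω, HasFDerivAt f (f' p) p)
    (h : ∀ d, HasDerivBound Ω v c k (fun p => c d p * W p) (fun p => f' p (v d))) :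
    HasDerivBound Ω v c (k + 1) W f := by
  refine ⟨hb, fun p hp => (hf p hp).differentiableAt, fun d => (h d).congr hΩ fun p hp => ?_⟩
  simp only [(hf p hp).fderiv]

theorem zero : HasDerivBound Ω v c k W (fun _ => (0 : F)) := by
  induction k generalizing W with
  | zero => exact ⟨0, le_rfl, fun p _ => by simp⟩
  | succ k ih =>
    exact ⟨⟨0, le_rfl, fun p _ => by simp⟩, fun p _ => differentiableAt_const _,
      fun d => by simpa using ih⟩

theorem const (a : F) {M : ℝ} (hM : 0 ≤ M) (hW : ∀ p ∈ Ω, 1 ≤ M * W p) :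
    HasDerivBound Ω v c k W (fun _ => a) := by
  have hb : ∃ C : ℝ, 0 ≤ C ∧ ∀ p ∈ Ω, ‖a‖ ≤ C * W p := by
    refine ⟨‖a‖ * M, by positivity, fun p hp => ?_⟩
    have := mul_le_mul_of_nonneg_left (hW p hp) (norm_nonneg a)
    linarith
  cases k with
  | zero => exact hb
  | succ k =>
    refine ⟨hb, fun p _ => differentiableAt_const _, fun d => ?_⟩
    simpa using zero

theorem add (hΩ : IsOpen Ω) (hf : HasDerivBound Ω v c k W f) (hg : HasDerivBound Ω v c k W g) :
    HasDerivBound Ω v c k W (fun p => f p + g p) := by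
  have key : ∀ (W : E → ℝ) (f g : E → F),
      (∃ C : ℝ, 0 ≤ C ∧ ∀ p ∈ Ω, ‖f p‖ ≤ C * W p) →
      (∃ C : ℝ, 0 ≤ C ∧ ∀ p ∈ Ω, ‖g p‖ ≤ C * W p) →
      ∃ C : ℝ, 0 ≤ C ∧ ∀ p ∈ Ω, ‖f p + g p‖ ≤ C * W p := by
    rintro W f g ⟨C, hC, h⟩ ⟨C', hC', h'⟩
    refine ⟨C + C', by positivity, fun p hp => (norm_add_le _ _).trans ?_⟩
    rw [add_mul]
    exact add_le_add (h p hp) (h' p hp)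
  induction k generalizing W f g with
  | zero => exact key W f g hf hg
  | succ k ih =>
    exact succ_of hΩ (key W f g hf.1 hg.1)
      (fun p hp => (hf.2.1 p hp).hasFDerivAt.add (hg.2.1 p hp).hasFDerivAt)
      fun d => ih (hf.2.2 d) (hg.2.2 d)

theorem mul (hΩ : IsOpen Ω) (hf : HasDerivBound Ω v c k W f)
    (hg : HasDerivBound Ω v c k W' g) :
    HasDerivBound Ω v c k (fun p => W p * W' p) (fun p => f p * g p) := by
  have key : ∀ (W W' : E → ℝ) (f g : E → F),
      (∃ C : ℝ, 0 ≤ C ∧ ∀ p ∈ Ω, ‖f p‖ ≤ C * W p) →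
      (∃ C : ℝ, 0 ≤ C ∧ ∀ p ∈ Ω, ‖g p‖ ≤ C * W' p) →
      ∃ C : ℝ, 0 ≤ C ∧ ∀ p ∈ Ω, ‖f p * g p‖ ≤ C * (W p * W' p) := by
    rintro W W' f g ⟨C, hC, h⟩ ⟨C', hC', h'⟩
    refine ⟨C * C', by positivity, fun p hp => (norm_mul_le _ _).trans ?_⟩
    calc ‖f p‖ * ‖g p‖ ≤ (C * W p) * (C' * W' p) :=
          mul_le_mul (h p hp) (h' p hp) (norm_nonneg _) ((norm_nonneg _).trans (h p hp))
      _ = _ := by ring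
  induction k generalizing W W' f g with
  | zero => exact key W W' f g hf hg
  | succ k ih =>
    refine succ_of hΩ (key W W' f g hf.1 hg.1)
      (fun p hp => (hf.2.1 p hp).hasFDerivAt.mul (hg.2.1 p hp).hasFDerivAt) fun d => ?_
    -- Leibniz rule: in each term one factor is differentiated, and the bound on the other is
    -- lowered to order k.
    have h1 := ih hf.of_succ (hg.2.2 d)
    have h2 := ih hg.of_succ (hf.2.2 d)
    have e1 : (fun p => W p * (c d p * W' p)) = fun p => c d p * (W p * W' p) := by
      funext p; ring
    have e2 : (fun p => W' p * (c d p * W p)) = fun p => c d p * (W p * W' p) := by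
      funext p; ring
    rw [e1] at h1
    rw [e2] at h2
    simpa using h1.add hΩ h2

theorem prod {ι : Type*} (hΩ : IsOpen Ω) (s : Finset ι) {w : ι → E → ℝ} {f : ι → E → F}
    (h : ∀ i ∈ s, HasDerivBound Ω v c k (w i) (f i)) :
    HasDerivBound Ω v c k (fun p => ∏ i ∈ s, w i p) (fun p => ∏ i ∈ s, f i p) := by
  classical
  induction s using Finset.induction_on with
  | empty => simpa using const (1 : F) zero_le_one (by simp)
  | insert i s hi ih =>
    simp only [Finset.prod_insert hi]
    exact (h i (Finset.mem_insert_self _ _)).mul hΩ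
      (ih fun j hj => h j (Finset.mem_insert_of_mem hj))

/-- Lets the two regimes of K, constant near 0 and decaying away from 0, be estimated separately.
The constants are added, hence the nonnegativity of weight and costs. -/
theorem union (hc : ∀ d, ∀ p ∈ Ω ∪ Ω', 0 ≤ c d p) (hW : ∀ p ∈ Ω ∪ Ω', 0 ≤ W p)
    (h : HasDerivBound Ω v c k W f) (h' : HasDerivBound Ω' v c k W f) :
    HasDerivBound (Ω ∪ Ω') v c k W f := by
  have key : ∀ (W : E → ℝ) (f : E → F), (∀ p ∈ Ω ∪ Ω', 0 ≤ W p) →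
      (∃ C : ℝ, 0 ≤ C ∧ ∀ p ∈ Ω, ‖f p‖ ≤ C * W p) →
      (∃ C : ℝ, 0 ≤ C ∧ ∀ p ∈ Ω', ‖f p‖ ≤ C * W p) →
      ∃ C : ℝ, 0 ≤ C ∧ ∀ p ∈ Ω ∪ Ω', ‖f p‖ ≤ C * W p := by
    rintro W f hW ⟨C, hC, h⟩ ⟨C', hC', h'⟩
    refine ⟨C + C', by positivity, fun p hp => ?_⟩
    have h0 := hW p hp
    have h1 := mul_nonneg hC h0
    have h2 := mul_nonneg hC' h0
    rcases hp with hp | hp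
    · linarith [h p hp]
    · linarith [h' p hp]
  induction k generalizing W f with
  | zero => exact key W f hW h h'
  | succ k ih =>
    refine ⟨key W f hW h.1 h'.1, ?_, fun d => ih (fun p hp => mul_nonneg (hc d p hp) (hW p hp))
      (h.2.2 d) (h'.2.2 d)⟩
    rintro p (hp | hp)
    exacts [h.2.1 p hp, h'.2.1 p hp]

theorem ofReal {f : E → ℝ} (hΩ : IsOpen Ω) (h : HasDerivBound Ω v c k W f) :
    HasDerivBound Ω v c k W (fun p => (f p : ℂ)) := by
  induction k generalizing W f with
  | zero => simpa [HasDerivBound] using h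
  | succ k ih =>
    refine succ_of hΩ (by simpa using h.1)
      (fun p hp => (Complex.ofRealCLM.hasFDerivAt (x := f p)).comp p (h.2.1 p hp).hasFDerivAt)
      fun d => ?_
    simpa using ih (h.2.2 d)

end HasDerivBound

end DerivBound

/-! ### Costs of x- and θ-derivatives, and the exponential factor. -/

/-- The coordinate directions of `ℝⁿ × ℝⁿ`. -/
def symDir {n : ℕ} : Fin n ⊕ Fin n → Rn n × Rn n :=
  Sum.elim (fun i => (EuclideanSpace.single i 1, 0)) (fun j => (0, EuclideanSpace.single j 1))

/-- An `x`-derivative costs `1 + |θ|`, a `θ`-derivative costs `|x| + (1 + |θ|)⁻¹`. -/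
def symCost {n : ℕ} : Fin n ⊕ Fin n → Rn n × Rn n → ℝ :=
  Sum.elim (fun _ p => 1 + ‖p.2‖) (fun _ p => ‖p.1‖ + (1 + ‖p.2‖)⁻¹)

/-- Bounds on the derivatives up to order `k` with the costs `symCost`. -/
abbrev HasSymBound {n : ℕ} {F : Type*} [NormedCommRing F] [NormedAlgebra ℝ F]
    (Ω : Set (Rn n × Rn n)) (k : ℕ) (W : Rn n × Rn n → ℝ) (f : Rn n × Rn n → F) : Prop :=
  HasDerivBound Ω symDir symCost k W f

section SymBound

variable {n : ℕ} {F : Type*} [NormedCommRing F] [NormedAlgebra ℝ F] {Ω : Set (Rn n × Rn n)}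

theorem symCost_pos (d : Fin n ⊕ Fin n) (p : Rn n × Rn n) : 0 < symCost d p := by
  rcases d with i | j <;> simp only [symCost, Sum.elim_inl, Sum.elim_inr] <;> positivity

/-- This is the purpose of the summand (1 + |θ|)⁻¹ in the θ-cost: a mixed second derivative of the
phase is merely bounded, and it must fit under the product of an x-cost and a θ-cost. -/
theorem one_le_mul_symCost (p : Rn n × Rn n) :
    1 ≤ (‖p.1‖ + (1 + ‖p.2‖)⁻¹) * (1 + ‖p.2‖) := by
  have h : 0 < 1 + ‖p.2‖ := by positivity
  rw [add_mul, inv_mul_cancel₀ h.ne']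
  have := mul_nonneg (norm_nonneg p.1) h.le
  linarith

theorem HasSymBound.weaken {k : ℕ} {W W' : Rn n × Rn n → ℝ} {f : Rn n × Rn n → F} (M : ℝ)
    (hM : 0 ≤ M) (hW : ∀ p ∈ Ω, W p ≤ M * W' p) (h : HasSymBound Ω k W f) :
    HasSymBound Ω k W' f :=
  HasDerivBound.mono (fun d p _ => (symCost_pos d p).le) hM hW h

theorem hasSymBound_comp_fst (hΩ : IsOpen Ω) {R : ℝ} (hR : ∀ p ∈ Ω, ‖p.1‖ < R) (k : ℕ)
    {h : Rn n → F} (hh : ContDiff ℝ ∞ h) : HasSymBound Ω k (fun _ => 1) (fun p => h p.1) := by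
  have key : ∀ h : Rn n → F, ContDiff ℝ ∞ h →
      ∃ C : ℝ, 0 ≤ C ∧ ∀ p ∈ Ω, ‖h p.1‖ ≤ C * 1 := by
    intro h hh
    obtain ⟨C, hC⟩ := (isCompact_closedBall (0 : Rn n) R).exists_bound_of_continuousOn
      hh.continuous.continuousOn
    refine ⟨|C|, abs_nonneg _, fun p hp => ?_⟩
    rw [mul_one]
    exact (hC p.1 (by simpa using (hR p hp).le)).trans (le_abs_self C)
  induction k generalizing h with
  | zero => exact key h hh
  | succ k ih =>
    refine HasDerivBound.succ_of hΩ (key h hh) (fun p _ =>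
      ((hh.differentiable (by simp)) p.1).hasFDerivAt.comp p hasFDerivAt_fst) ?_
    rintro (i | j)
    · have := ih (h := fun x => fderiv ℝ h x (EuclideanSpace.single i 1))
        ((hh.fderiv_right (m := ∞) (by simp)).clm_apply contDiff_const)
      refine HasSymBound.weaken 1 zero_le_one (fun p _ => ?_) this
      simp [symCost]
    · simpa [symDir] using! HasDerivBound.zero

theorem hasSymBound_clm_snd (hΩ : IsOpen Ω) (k : ℕ) (L : Rn n →L[ℝ] ℝ) :
    HasSymBound Ω k (fun p => 1 + ‖p.2‖) (fun p => L p.2) := by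
  have hb : ∃ C : ℝ, 0 ≤ C ∧ ∀ p ∈ Ω, ‖L p.2‖ ≤ C * (1 + ‖p.2‖) := by
    refine ⟨‖L‖, norm_nonneg _, fun p _ => (L.le_opNorm _).trans ?_⟩
    gcongr
    linarith
  cases k with
  | zero => exact hb
  | succ k =>
    refine HasDerivBound.succ_of hΩ hb
      (fun p _ => L.hasFDerivAt.comp p hasFDerivAt_snd) ?_
    rintro (i | j)
    · simpa [symDir] using! HasDerivBound.zero
    · refine HasDerivBound.const _ zero_le_one fun p _ => ?_
      simpa [symCost] using one_le_mul_symCost p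

/-- A θ-derivative of the exponential brings down φ(x), so φ has to be controlled by the θ-cost. The
bound C|x| is given near 0 and extends to |x| < R by compactness. -/
theorem hasSymBound_phase_left (hΩ : IsOpen Ω) {R : ℝ} (hR : ∀ p ∈ Ω, ‖p.1‖ < R) (k : ℕ)
    {φ : Rn n → ℝ} (hφ : ContDiff ℝ ∞ φ) {C : ℝ} (hC : ∀ x : Rn n, ‖x‖ ≤ 1 → |φ x| ≤ C * ‖x‖) :
    HasSymBound Ω k (fun p => ‖p.1‖ + (1 + ‖p.2‖)⁻¹) (fun p => φ p.1) := by
  have hb : ∃ C : ℝ, 0 ≤ C ∧ ∀ p ∈ Ω, ‖φ p.1‖ ≤ C * (‖p.1‖ + (1 + ‖p.2‖)⁻¹) := by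
    obtain ⟨M, hM⟩ := (isCompact_closedBall (0 : Rn n) R).exists_bound_of_continuousOn
      hφ.continuous.continuousOn
    refine ⟨|C| + |M|, by positivity, fun p hp => ?_⟩
    have h1 : ‖φ p.1‖ ≤ (|C| + |M|) * ‖p.1‖ := by
      have hn := norm_nonneg p.1
      rcases le_total ‖p.1‖ 1 with h | h
      · have h2 : C * ‖p.1‖ ≤ |C| * ‖p.1‖ := mul_le_mul_of_nonneg_right (le_abs_self C) hn
        have h3 := mul_nonneg (abs_nonneg M) hn
        have h4 := hC p.1 h
        rw [Real.norm_eq_abs]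
        linarith
      · have h2 : |M| * 1 ≤ |M| * ‖p.1‖ := mul_le_mul_of_nonneg_left h (abs_nonneg M)
        have h3 := mul_nonneg (abs_nonneg C) hn
        have h4 := hM p.1 (by simpa using (hR p hp).le)
        linarith [le_abs_self M]
    refine h1.trans ?_
    gcongr
    have : 0 ≤ (1 + ‖p.2‖)⁻¹ := by positivity
    linarith
  cases k with
  | zero => exact hb
  | succ k =>
    refine HasDerivBound.succ_of hΩ hb (fun p _ =>
      ((hφ.differentiable (by simp)) p.1).hasFDerivAt.comp p hasFDerivAt_fst) ?_
    rintro (i | j)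
    · have := hasSymBound_comp_fst hΩ hR k
        (h := fun x => fderiv ℝ φ x (EuclideanSpace.single i 1))
        ((hφ.fderiv_right (m := ∞) (by simp)).clm_apply contDiff_const)
      refine HasSymBound.weaken 1 zero_le_one (fun p _ => ?_) this
      simpa [symCost, mul_comm] using one_le_mul_symCost p
    · simpa [symDir] using! HasDerivBound.zero

/-- Each derivative reproduces the exponential times ∂ᵢφ(x)L(θ) or φ(x)L(eⱼ), which are of the size
of the respective costs; induction on the order closes the loop. -/
theorem hasSymBound_exp_phase (hΩ : IsOpen Ω) {R : ℝ} (hR : ∀ p ∈ Ω, ‖p.1‖ < R) (k : ℕ)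
    {φ : Rn n → ℝ} (hφ : ContDiff ℝ ∞ φ) {C : ℝ} (hC : ∀ x : Rn n, ‖x‖ ≤ 1 → |φ x| ≤ C * ‖x‖)
    (L : Rn n →L[ℝ] ℝ) :
    HasSymBound Ω k (fun _ => 1)
      (fun p => Complex.exp (-(Complex.I * ((φ p.1 * L p.2 : ℝ) : ℂ)))) := by
  have hb : ∃ C : ℝ, 0 ≤ C ∧ ∀ p ∈ Ω,
      ‖Complex.exp (-(Complex.I * ((φ p.1 * L p.2 : ℝ) : ℂ)))‖ ≤ C * 1 :=
    ⟨1, zero_le_one, fun p _ => by simp [Complex.norm_exp]⟩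
  induction k with
  | zero => exact hb
  | succ k ih =>
    have hu : ∀ p ∈ Ω, HasFDerivAt (fun p : Rn n × Rn n => φ p.1 * L p.2)
        (φ p.1 • L.comp (ContinuousLinearMap.snd ℝ _ _) +
          L p.2 • (fderiv ℝ φ p.1).comp (ContinuousLinearMap.fst ℝ _ _)) p := fun p _ =>
      (((hφ.differentiable (by simp)) p.1).hasFDerivAt.comp p hasFDerivAt_fst).mul
        (L.hasFDerivAt.comp p hasFDerivAt_snd)
    refine HasDerivBound.succ_of hΩ hb (fun p hp =>
      ((((Complex.ofRealCLM.hasFDerivAt (x := φ p.1 * L p.2)).comp p (hu p hp)).const_mul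
        Complex.I).neg).cexp) ?_
    rintro (i | j)
    · have h1 := (hasSymBound_comp_fst hΩ hR k
        (h := fun x => fderiv ℝ φ x (EuclideanSpace.single i 1))
        ((hφ.fderiv_right (m := ∞) (by simp)).clm_apply contDiff_const)).mul hΩ
        (hasSymBound_clm_snd hΩ k L)
      have h2 := ((HasDerivBound.const (Ω := Ω) (v := symDir) (c := symCost) (k := k)
        (W := fun _ => 1) (-Complex.I) zero_le_one (by simp)).mul hΩ (h1.ofReal hΩ)).mul hΩ ih
      refine HasSymBound.weaken 1 zero_le_one (fun p _ => ?_) (h2.congr hΩ fun p _ => ?_)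
      · simp [symCost]
      · simp [symDir]
        ring
    · have h1 := hasSymBound_phase_left hΩ hR k hφ hC
      have h2 := ((HasDerivBound.const (Ω := Ω) (v := symDir) (c := symCost) (k := k)
        (W := fun _ => 1) (-Complex.I * L (EuclideanSpace.single j 1)) zero_le_one
        (by simp)).mul hΩ (h1.ofReal hΩ)).mul hΩ ih
      refine HasSymBound.weaken 1 zero_le_one (fun p _ => ?_) (h2.congr hΩ fun p _ => ?_)
      · simp [symCost]
      · simp [symDir]
        ring

end SymBound

theorem ContDiffOn.hasDerivAt_iteratedDeriv {f : ℝ → ℝ} {s : Set ℝ} (hs : IsOpen s)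
    (hf : ContDiffOn ℝ ∞ f s) (m : ℕ) {t : ℝ} (ht : t ∈ s) :
    HasDerivAt (iteratedDeriv m f) (iteratedDeriv (m + 1) f t) t := by
  rw [iteratedDeriv_succ]
  refine DifferentiableAt.hasDerivAt ?_
  have h := (hf.differentiableOn_iteratedDerivWithin (m := m) (by exact_mod_cast WithTop.coe_lt_top _)
    hs.uniqueDiffOn) t ht
  refine (h.differentiableAt (hs.mem_nhds ht)).congr_of_eventuallyEq ?_
  filter_upwards [hs.mem_nhds ht] with y hy
  exact (iteratedDerivWithin_of_isOpen hs hy).symm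

theorem hasFDerivAt_norm_of_ne_zero {V : Type*} [NormedAddCommGroup V] [InnerProductSpace ℝ V]
    {x : V} (hx : x ≠ 0) : HasFDerivAt (fun y : V => ‖y‖) (‖x‖⁻¹ • innerSL ℝ x) x := by
  have h0 : ‖x‖ ≠ 0 := norm_ne_zero_iff.2 hx
  have h := (hasStrictFDerivAt_norm_sq x).hasFDerivAt.sqrt (by positivity)
  simp only [Real.sqrt_sq (norm_nonneg _)] at h
  convert h using 1
  ext v
  simp
  field_simp

/-! ### Radial functions where (1 + |θ|)|x| is bounded below. -/

section RadialBound

variable {n : ℕ} {Ω : Set (Rn n × Rn n)} {M : ℝ}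

theorem hasFDerivAt_norm_fst {p : Rn n × Rn n} (hp : p.1 ≠ 0) :
    HasFDerivAt (fun q : Rn n × Rn n => ‖q.1‖)
      ((‖p.1‖⁻¹ • innerSL ℝ p.1).comp (ContinuousLinearMap.fst ℝ _ _)) p :=
  (hasFDerivAt_norm_of_ne_zero hp).comp p hasFDerivAt_fst

/-- The hypothesis `hA` says |x|⁻¹ ≤ M(1 + |θ|): in such a region an x-derivative may lose a factor
|x|⁻¹, as it does for functions homogeneous in x. -/
theorem hasSymBound_coord_fst (hΩ : IsOpen Ω) (hM : 0 ≤ M)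
    (hA : ∀ p ∈ Ω, 1 ≤ M * ((1 + ‖p.2‖) * ‖p.1‖)) (k : ℕ) (i : Fin n) :
    HasSymBound Ω k (fun p => ‖p.1‖) (fun p => p.1 i) := by
  have hb : ∃ C : ℝ, 0 ≤ C ∧ ∀ p ∈ Ω, ‖p.1 i‖ ≤ C * ‖p.1‖ :=
    ⟨1, zero_le_one, fun p _ => by simpa using PiLp.norm_apply_le p.1 i⟩
  cases k with
  | zero => exact hb
  | succ k =>
    refine HasDerivBound.succ_of hΩ hb (fun p _ =>
      (EuclideanSpace.proj (𝕜 := ℝ) i).hasFDerivAt.comp p hasFDerivAt_fst) ?_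
    rintro (l | j)
    · refine HasDerivBound.const _ hM fun p hp => ?_
      simpa [symCost] using hA p hp
    · simpa [symDir] using! HasDerivBound.zero

theorem hasSymBound_inv_norm_fst (hΩ : IsOpen Ω) (h0 : ∀ p ∈ Ω, p.1 ≠ 0) (hM : 0 ≤ M)
    (hA : ∀ p ∈ Ω, 1 ≤ M * ((1 + ‖p.2‖) * ‖p.1‖)) (k : ℕ) :
    HasSymBound Ω k (fun p => ‖p.1‖⁻¹) (fun p => ‖p.1‖⁻¹) := by
  have hb : ∃ C : ℝ, 0 ≤ C ∧ ∀ p ∈ Ω, ‖‖p.1‖⁻¹‖ ≤ C * ‖p.1‖⁻¹ :=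
    ⟨1, zero_le_one, fun p _ => by simp⟩
  induction k with
  | zero => exact hb
  | succ k ih =>
    refine HasDerivBound.succ_of hΩ hb (fun p hp =>
      (hasDerivAt_inv (norm_ne_zero_iff.2 (h0 p hp))).hasFDerivAt.comp p
        (hasFDerivAt_norm_fst (h0 p hp))) ?_
    rintro (i | j)
    · have h1 := ((((hasSymBound_coord_fst hΩ hM hA k i).mul hΩ ih).mul hΩ ih).mul hΩ ih).mul hΩ
        (HasDerivBound.const (W := fun _ => 1) (-1 : ℝ) zero_le_one (by simp))
      refine HasSymBound.weaken M hM (fun p hp => ?_) (h1.congr hΩ fun p hp => ?_)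
      · have hr : 0 < ‖p.1‖ := norm_pos_iff.2 (h0 p hp)
        have := hA p hp
        simp only [symCost, Sum.elim_inl]
        field_simp
        linarith
      · simp [symDir, EuclideanSpace.inner_single_right]
        ring
    · simpa [symDir] using! HasDerivBound.zero

theorem hasSymBound_radial (hΩ : IsOpen Ω) (h0 : ∀ p ∈ Ω, p.1 ≠ 0) (hM : 0 ≤ M)
    (hA : ∀ p ∈ Ω, 1 ≤ M * ((1 + ‖p.2‖) * ‖p.1‖)) {h : ℝ → ℝ}
    (hh : ContDiffOn ℝ ∞ h (Ioi 0))
    (hb : ∀ m : ℕ, ∃ C : ℝ, 0 ≤ C ∧ ∀ t : ℝ, 0 < t → |iteratedDeriv m h t| ≤ C * (t ^ m)⁻¹)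
    (k m : ℕ) :
    HasSymBound Ω k (fun p => (‖p.1‖ ^ m)⁻¹) (fun p => iteratedDeriv m h ‖p.1‖) := by
  have hb : ∀ m : ℕ, ∃ C : ℝ, 0 ≤ C ∧ ∀ p ∈ Ω,
      ‖iteratedDeriv m h ‖p.1‖‖ ≤ C * (‖p.1‖ ^ m)⁻¹ := fun m => by
    obtain ⟨C, hC, h⟩ := hb m
    exact ⟨C, hC, fun p hp => h _ (norm_pos_iff.2 (h0 p hp))⟩
  induction k generalizing m with
  | zero => exact hb m
  | succ k ih =>
    have hu : ∀ p ∈ Ω, HasFDerivAt (fun p : Rn n × Rn n => iteratedDeriv m h ‖p.1‖) _ p :=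
      fun p hp => HasFDerivAt.comp (g := iteratedDeriv m h) p (hh.hasDerivAt_iteratedDeriv
        isOpen_Ioi m (mem_Ioi.2 (norm_pos_iff.2 (h0 p hp)))).hasFDerivAt
        (hasFDerivAt_norm_fst (h0 p hp))
    refine HasDerivBound.succ_of hΩ (hb m) hu ?_
    rintro (i | j)
    · have h1 := ((hasSymBound_coord_fst hΩ hM hA k i).mul hΩ
        (hasSymBound_inv_norm_fst hΩ h0 hM hA k)).mul hΩ (ih (m + 1))
      refine HasSymBound.weaken M hM (fun p hp => ?_) (h1.congr hΩ fun p hp => ?_)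
      · have hr : 0 < ‖p.1‖ := norm_pos_iff.2 (h0 p hp)
        have := hA p hp
        simp only [symCost, Sum.elim_inl, pow_succ]
        field_simp
        linarith
      · simp [symDir, EuclideanSpace.inner_single_right]
        ring
    · simpa [symDir] using! HasDerivBound.zero

theorem hasSymBound_norm_fst (hΩ : IsOpen Ω) (h0 : ∀ p ∈ Ω, p.1 ≠ 0) (hM : 0 ≤ M)
    (hA : ∀ p ∈ Ω, 1 ≤ M * ((1 + ‖p.2‖) * ‖p.1‖)) (k : ℕ) :
    HasSymBound Ω k (fun p => ‖p.1‖) (fun p => ‖p.1‖) := by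
  have hb : ∃ C : ℝ, 0 ≤ C ∧ ∀ p ∈ Ω, ‖‖p.1‖‖ ≤ C * ‖p.1‖ :=
    ⟨1, zero_le_one, fun p _ => by simp⟩
  cases k with
  | zero => exact hb
  | succ k =>
    refine HasDerivBound.succ_of hΩ hb (fun p hp => hasFDerivAt_norm_fst (h0 p hp)) ?_
    rintro (i | j)
    · have h1 := (hasSymBound_coord_fst hΩ hM hA k i).mul hΩ
        (hasSymBound_inv_norm_fst hΩ h0 hM hA k)
      refine HasSymBound.weaken M hM (fun p hp => ?_) (h1.congr hΩ fun p hp => ?_)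
      · have hr : 0 < ‖p.1‖ := norm_pos_iff.2 (h0 p hp)
        have := hA p hp
        simp only [symCost, Sum.elim_inl]
        field_simp
        linarith
      · simp [symDir, EuclideanSpace.inner_single_right]
        ring
    · simpa [symDir] using! HasDerivBound.zero

/-- Bounds for `κ (g(x) θ_j)` with `g(x) = b(|x|) |x|` and a rapidly decreasing `κ = κ_m`, where
`κ_{m + 1}` is the derivative of `κ_m`, in a region where `(1 + |θ|) |x|` is bounded below. -/
theorem hasSymBound_scaled (hΩ : IsOpen Ω) (h0 : ∀ p ∈ Ω, p.1 ≠ 0) (hM : 0 ≤ M)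
    (hA : ∀ p ∈ Ω, 1 ≤ M * ((1 + ‖p.2‖) * ‖p.1‖)) {b : ℝ → ℝ}
    (hs : ContDiffOn ℝ ∞ b (Ioi 0))
    (hb : ∀ m : ℕ, ∃ C : ℝ, 0 ≤ C ∧ ∀ t : ℝ, 0 < t → |iteratedDeriv m b t| ≤ C * (t ^ m)⁻¹)
    {κ : ℕ → ℝ → ℂ} (hκ : ∀ m t, HasDerivAt (κ m) (κ (m + 1) t) t) {w : ℝ → ℝ}
    (hw : ∀ m, ∃ C : ℝ, 0 ≤ C ∧ ∀ t, ‖κ m t‖ ≤ C * w t) (hw0 : ∀ t, 0 ≤ w t)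
    (j : Fin n) (k m : ℕ) :
    HasSymBound Ω k (fun p => w (b ‖p.1‖ * ‖p.1‖ * p.2 j))
      (fun p => κ m (b ‖p.1‖ * ‖p.1‖ * p.2 j)) := by
  have hbd : ∀ m, ∃ C : ℝ, 0 ≤ C ∧ ∀ p ∈ Ω, ‖κ m (b ‖p.1‖ * ‖p.1‖ * p.2 j)‖ ≤
      C * w (b ‖p.1‖ * ‖p.1‖ * p.2 j) := fun m => by
    obtain ⟨C, hC, h⟩ := hw m
    exact ⟨C, hC, fun p _ => h _⟩
  induction k generalizing m with
  | zero => exact hbd m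
  | succ k ih =>
    have hu : ∀ p ∈ Ω, HasFDerivAt (fun p : Rn n × Rn n => b ‖p.1‖ * ‖p.1‖ * p.2 j) _ p :=
      fun p hp => ((((hs.hasDerivAt_iteratedDeriv isOpen_Ioi 0
        (mem_Ioi.2 (norm_pos_iff.2 (h0 p hp)))).hasFDerivAt.comp p
        (hasFDerivAt_norm_fst (h0 p hp))).mul (hasFDerivAt_norm_fst (h0 p hp))).mul
        ((EuclideanSpace.proj (𝕜 := ℝ) j).hasFDerivAt.comp p hasFDerivAt_snd))
    refine HasDerivBound.succ_of hΩ (hbd m) (fun p hp =>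
      (hκ m _).hasFDerivAt.comp p (hu p hp)) ?_
    have hr := hasSymBound_norm_fst hΩ h0 hM hA k
    have hi := hasSymBound_inv_norm_fst hΩ h0 hM hA k
    have hb0 := hasSymBound_radial hΩ h0 hM hA hs hb k 0
    have hb1 := hasSymBound_radial hΩ h0 hM hA hs hb k 1
    rintro (i | l)
    · have hc := hasSymBound_coord_fst hΩ hM hA k i
      -- The two pieces of ∂ᵢg are of order zero, since b is bounded and |b'(t)| ≤ C/t; the
      -- remaining factor θⱼ is paid for by the x-cost.
      have hg1 : HasSymBound Ω k (fun _ => 1)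
          (fun p => b ‖p.1‖ * p.1 i * ‖p.1‖⁻¹) := by
        refine HasSymBound.weaken 1 zero_le_one (fun p hp => ?_)
          (((hb0.mul hΩ hc).mul hΩ hi).congr hΩ fun p hp => ?_)
        · have hr : 0 < ‖p.1‖ := norm_pos_iff.2 (h0 p hp)
          field_simp
          simp
        · simp
      have hg2 : HasSymBound Ω k (fun _ => 1)
          (fun p => iteratedDeriv 1 b ‖p.1‖ * p.1 i * ‖p.1‖⁻¹ * ‖p.1‖) := by
        refine HasSymBound.weaken 1 zero_le_one (fun p hp => ?_)
          (((hb1.mul hΩ hc).mul hΩ hi).mul hΩ hr)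
        have hr : 0 < ‖p.1‖ := norm_pos_iff.2 (h0 p hp)
        field_simp
        simp
      have hθ := hasSymBound_clm_snd hΩ k (EuclideanSpace.proj (𝕜 := ℝ) j)
      have h1 := (((hg1.add hΩ hg2).mul hΩ hθ).ofReal hΩ).mul hΩ (ih (m + 1))
      refine HasSymBound.weaken 1 zero_le_one (fun p hp => ?_) (h1.congr hΩ fun p hp => ?_)
      · simp [symCost]
      · simp [symDir, EuclideanSpace.inner_single_right]
        ring
    · have h1 := (((hb0.mul hΩ hr).mul hΩ (HasDerivBound.const (W := fun _ => 1)
        ((EuclideanSpace.single l (1 : ℝ) : Rn n) j) zero_le_one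
        (by simp))).ofReal hΩ).mul hΩ (ih (m + 1))
      refine HasSymBound.weaken 1 zero_le_one (fun p hp => ?_) (h1.congr hΩ fun p hp => ?_)
      · simp only [symCost, Sum.elim_inr, pow_zero, inv_one, one_mul, mul_one]
        refine mul_le_mul_of_nonneg_right ?_ (hw0 _)
        have : 0 ≤ (1 + ‖p.2‖)⁻¹ := by positivity
        linarith
      · simp [symDir]
        split_ifs <;> simp

end RadialBound

/-! ### Passage to multi-indices, Schwartz bounds, and linearity of ψ. -/

theorem HasDerivBound.iterate {D E F : Type*} [NormedAddCommGroup E] [NormedSpace ℝ E]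
    [NormedCommRing F] [NormedAlgebra ℝ F] {Ω : Set E} {v : D → E} {c : D → E → ℝ} {k : ℕ}
    {W : E → ℝ} {f : E → F} (d : D) (m : ℕ) (h : HasDerivBound Ω v c (k + m) W f) :
    HasDerivBound Ω v c k (fun p => c d p ^ m * W p)
      ((fun (f : E → F) p => fderiv ℝ f p (v d))^[m] f) := by
  induction m generalizing W f with
  | zero => simpa using h
  | succ m ih =>
    have := ih (h.2.2 d)
    rw [Function.iterate_succ_apply]
    simpa only [pow_succ, mul_assoc] using this

theorem HasDerivBound.foldr_iterate {D E F ι : Type*} [NormedAddCommGroup E] [NormedSpace ℝ E]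
    [NormedCommRing F] [NormedAlgebra ℝ F] {Ω : Set E} {v : D → E} {c : D → E → ℝ} {k : ℕ}
    {W A : E → ℝ} {f : E → F} (d : ι → D) (hA : ∀ i, c (d i) = A) (α : ι → ℕ) (l : List ι)
    (h : HasDerivBound Ω v c (k + (l.map α).sum) W f) :
    HasDerivBound Ω v c k (fun p => A p ^ (l.map α).sum * W p)
      (l.foldr (fun i f => (fun (f : E → F) p => fderiv ℝ f p (v (d i)))^[α i] f) f) := by
  induction l generalizing k with
  | nil => simpa using h
  | cons i l ih =>
    have h1 := ih (k := k + α i) (by simpa [add_assoc] using h)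
    simpa [hA, pow_add, mul_assoc] using h1.iterate (d i) (α i)

theorem HasSymBound.multiPartial {n : ℕ} {Ω : Set (Rn n × Rn n)} {W : Rn n × Rn n → ℝ}
    {a : Rn n × Rn n → ℂ} (h : ∀ k, HasSymBound Ω k W a) (α γ : Fin n → ℕ) :
    ∃ C : ℝ, 0 ≤ C ∧ ∀ p ∈ Ω, ‖multiPartialX α (multiPartialTheta γ a) p‖ ≤
      C * ((1 + ‖p.2‖) ^ (∑ i, α i) *
        ((‖p.1‖ + (1 + ‖p.2‖)⁻¹) ^ (∑ j, γ j) * W p)) := by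
  rw [Fin.sum_univ_def, Fin.sum_univ_def]
  -- The θ-derivatives are taken first, keeping |α| orders in reserve for the x-derivatives.
  have h1 := HasDerivBound.foldr_iterate (k := ((List.finRange n).map α).sum)
    (Sum.inr : Fin n → Fin n ⊕ Fin n) (fun _ => rfl) γ (List.finRange n) (h _)
  have h2 := HasDerivBound.foldr_iterate (k := 0)
    (Sum.inl : Fin n → Fin n ⊕ Fin n) (fun _ => rfl) α (List.finRange n) (by simpa using h1)
  exact h2.bound

theorem SchwartzMap.exists_bound_iteratedDeriv (K : 𝓢(ℝ, ℂ)) (N m : ℕ) :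
    ∃ C : ℝ, 0 ≤ C ∧ ∀ t : ℝ, ‖iteratedDeriv m K t‖ ≤ C * ((1 + |t|) ^ N)⁻¹ := by
  refine ⟨2 ^ N * (Finset.Iic (N, m)).sup (fun m => SchwartzMap.seminorm ℝ m.1 m.2) K,
    by positivity, fun t => ?_⟩
  have h := SchwartzMap.one_add_le_sup_seminorm_apply (𝕜 := ℝ) (m := (N, m)) (k := N) (n := m)
    le_rfl le_rfl K t
  rw [norm_iteratedFDeriv_eq_norm_iteratedDeriv, Real.norm_eq_abs] at h
  rw [← div_eq_mul_inv, le_div_iff₀ (by positivity)]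
  linarith

theorem SchwartzMap.hasDerivAt_iteratedDeriv (K : 𝓢(ℝ, ℂ)) (m : ℕ) (t : ℝ) :
    HasDerivAt (iteratedDeriv m K) (iteratedDeriv (m + 1) K t) t := by
  rw [iteratedDeriv_succ]
  exact (((K.smooth ⊤).differentiable_iteratedDeriv m
    (by exact_mod_cast WithTop.coe_lt_top _)) t).hasDerivAt

/-- Homogeneity makes the difference quotient of ψ at 0 along θ equal to ψ(θ) for every t > 0, so ψ
is its own derivative at the origin. -/
theorem exists_clm_of_homogeneous {V : Type*} [NormedAddCommGroup V] [NormedSpace ℝ V]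
    {ψ : V → ℝ} (hd : DifferentiableAt ℝ ψ 0)
    (hψ : ∀ (t : ℝ) (θ : V), 0 < t → ψ (t • θ) = t * ψ θ) : ∃ L : V →L[ℝ] ℝ, ψ = L := by
  have h0 : ψ 0 = 0 := by
    have := hψ 2 0 (by norm_num)
    rw [smul_zero] at this
    linarith
  refine ⟨fderiv ℝ ψ 0, funext fun θ => ?_⟩
  have h1 : HasDerivAt (fun t : ℝ => ψ (t • θ)) (fderiv ℝ ψ 0 θ) 0 := by
    have h2 : HasDerivAt (fun t : ℝ => t • θ) θ 0 := by
      simpa using (hasDerivAt_id (0 : ℝ)).smul_const θ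
    have h3 : HasFDerivAt ψ (fderiv ℝ ψ 0) ((fun t : ℝ => t • θ) 0) := by
      simpa using hd.hasFDerivAt
    exact h3.comp_hasDerivAt (0 : ℝ) h2
  refine tendsto_nhds_unique (tendsto_const_nhds.congr' ?_) h1.tendsto_slope_zero_right
  filter_upwards [self_mem_nhdsWithin] with t ht
  have ht : (0 : ℝ) < t := ht
  simp [hψ t θ ht, h0, ht.ne']

/-! ### The symbol belongs to the Hörmander classes. -/

section Symbol

variable {n : ℕ} {b : ℝ → ℝ}

theorem IsKumanoGo.continuous_scaled (hb : IsKumanoGo b) (j : Fin n) :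
    Continuous fun p : Rn n × Rn n => b ‖p.1‖ * ‖p.1‖ * p.2 j := by
  have h1 : Continuous fun p : Rn n × Rn n => b ‖p.1‖ :=
    hb.continuousOn.comp_continuous continuous_fst.norm fun p => norm_nonneg p.1
  have h2 : Continuous fun p : Rn n × Rn n => p.2 j := by fun_prop
  exact (h1.mul continuous_fst.norm).mul h2

theorem IsKumanoGo.strictMonoOn (hb : IsKumanoGo b) : StrictMonoOn b (Ici 0) :=
  strictMonoOn_of_deriv_pos (convex_Ici 0) hb.continuousOn fun t ht =>
    hb.deriv_pos t (by simpa using ht)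

theorem IsKumanoGo.nonneg (hb : IsKumanoGo b) {t : ℝ} (ht : 0 ≤ t) : 0 ≤ b t := by
  rw [← hb.zero]
  exact hb.strictMonoOn.monotoneOn self_mem_Ici ht ht

theorem IsKumanoGo.pos (hb : IsKumanoGo b) {t : ℝ} (ht : 0 < t) : 0 < b t := by
  rw [← hb.zero]
  exact hb.strictMonoOn self_mem_Ici ht.le ht

/-- Two overlapping open sets are used, with s = g(x)θⱼ. Where |s| < δ the function is constant.
Where |s| > δ/2 one has x ≠ 0, and |s| ≤ B|x|(1 + |θ|) gives the lower bound on (1 + |θ|)|x| with M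
= 2B/δ. -/
theorem hasSymBound_schwartz_scaled (hb : IsKumanoGo b) {B : ℝ}
    (hB : ∀ t, 0 ≤ t → |b t| ≤ B) (K : 𝓢(ℝ, ℂ)) {δ : ℝ} (hδ : 0 < δ)
    (hK : ∀ t ∈ Icc (-δ) δ, K t = 1) (j : Fin n) (N k : ℕ) :
    HasSymBound (univ : Set (Rn n × Rn n)) k
      (fun p => ((1 + |b ‖p.1‖ * ‖p.1‖ * p.2 j|) ^ N)⁻¹)
      (fun p => K (b ‖p.1‖ * ‖p.1‖ * p.2 j)) := by
  have hcont : Continuous fun p : Rn n × Rn n => |b ‖p.1‖ * ‖p.1‖ * p.2 j| :=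
    (hb.continuous_scaled j).abs
  have hB0 : 0 ≤ B := (abs_nonneg _).trans (hB 0 le_rfl)
  set Ω₁ : Set (Rn n × Rn n) := {p | |b ‖p.1‖ * ‖p.1‖ * p.2 j| < δ} with hΩ₁
  set Ω₂ : Set (Rn n × Rn n) := {p | δ / 2 < |b ‖p.1‖ * ‖p.1‖ * p.2 j|} with hΩ₂
  have ho₁ : IsOpen Ω₁ := isOpen_lt hcont continuous_const
  have ho₂ : IsOpen Ω₂ := isOpen_lt continuous_const hcont
  have hu : univ = Ω₁ ∪ Ω₂ := by
    refine (eq_univ_of_forall fun p => ?_).symm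
    rcases lt_or_ge |b ‖p.1‖ * ‖p.1‖ * p.2 j| δ with h | h
    · exact Or.inl h
    · exact Or.inr (show δ / 2 < _ by linarith)
  rw [hu]
  refine HasDerivBound.union (fun d p _ => (symCost_pos d p).le) (fun p _ => by positivity) ?_ ?_
  · refine (HasDerivBound.const (1 : ℂ) (M := (1 + δ) ^ N) (by positivity) fun p hp => ?_).congr
      ho₁ fun p hp => ?_
    · rw [← div_eq_mul_inv, one_le_div (by positivity)]
      have hp : |b ‖p.1‖ * ‖p.1‖ * p.2 j| < δ := hp
      gcongr
    · exact (hK _ ⟨(abs_lt.1 hp).1.le, (abs_lt.1 hp).2.le⟩).symm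
  · have h0 : ∀ p ∈ Ω₂, p.1 ≠ 0 := by
      intro p hp h0
      have hp : δ / 2 < |b ‖p.1‖ * ‖p.1‖ * p.2 j| := hp
      simp [h0] at hp
      linarith
    refine hasSymBound_scaled ho₂ h0 (M := 2 * B / δ) (by positivity) (fun p hp => ?_) hb.smooth
      (fun m => ?_) (fun m t => K.hasDerivAt_iteratedDeriv m t)
      (w := fun t => ((1 + |t|) ^ N)⁻¹) (fun m => K.exists_bound_iteratedDeriv N m)
      (fun t => by positivity) j k 0
    · have hp : δ / 2 < |b ‖p.1‖ * ‖p.1‖ * p.2 j| := hp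
      have h1 : |b ‖p.1‖ * ‖p.1‖ * p.2 j| ≤ B * ‖p.1‖ * (1 + ‖p.2‖) := by
        rw [abs_mul, abs_mul, abs_norm]
        have := PiLp.norm_apply_le p.2 j
        rw [Real.norm_eq_abs] at this
        gcongr
        · exact hB _ (norm_nonneg _)
        · linarith
      rw [div_mul_eq_mul_div, one_le_div hδ]
      linarith
    · rcases Nat.eq_zero_or_pos m with rfl | hm
      · exact ⟨B, hB0, fun t ht => by simpa using hB t ht.le⟩
      · obtain ⟨C, hC, h⟩ := hb.deriv_bound m hm
        exact ⟨C, hC.le, h⟩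

theorem hasSymBound_kumanoGoSymbol (hb : IsKumanoGo b) {B : ℝ}
    (hB : ∀ t, 0 ≤ t → |b t| ≤ B) {φ : Rn n → ℝ} (hφ : ContDiff ℝ ∞ φ) {C : ℝ}
    (hC : ∀ x : Rn n, ‖x‖ ≤ 1 → |φ x| ≤ C * ‖x‖) (L : Rn n →L[ℝ] ℝ) (K : 𝓢(ℝ, ℂ)) {δ : ℝ}
    (hδ : 0 < δ) (hK : ∀ t ∈ Icc (-δ) δ, K t = 1) {χ : ℝ → ℂ} (hχ : ContDiff ℝ ∞ χ) (R : ℝ)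
    (N k : ℕ) :
    HasSymBound {p : Rn n × Rn n | ‖p.1‖ < R} k
      (fun p => ∏ j, ((1 + |b ‖p.1‖ * ‖p.1‖ * p.2 j|) ^ N)⁻¹) (kumanoGoSymbol φ L χ K b) := by
  have hΩ : IsOpen {p : Rn n × Rn n | ‖p.1‖ < R} :=
    isOpen_lt continuous_fst.norm continuous_const
  have h1 := hasSymBound_exp_phase hΩ (R := R) (fun p hp => hp) k hφ hC L
  have h2 := HasDerivBound.prod hΩ Finset.univ fun j _ => (hasSymBound_comp_fst hΩ (R := R)
    (fun p hp => hp) k (h := fun x : Rn n => χ (x j))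
    (hχ.comp (EuclideanSpace.proj (𝕜 := ℝ) j).contDiff)).mul hΩ
    ((hasSymBound_schwartz_scaled hb hB K hδ hK j N k).subset (subset_univ _))
  simpa only [one_mul] using! h1.mul hΩ h2

theorem contDiff_kumanoGoSymbol (hb : IsKumanoGo b) {φ ψ : Rn n → ℝ} (hφ : ContDiff ℝ ∞ φ)
    (hψ : ContDiff ℝ ∞ ψ) (K : 𝓢(ℝ, ℂ)) {δ : ℝ} (hδ : 0 < δ)
    (hK : ∀ t ∈ Icc (-δ) δ, K t = 1) {χ : ℝ → ℂ} (hχ : ContDiff ℝ ∞ χ) :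
    ContDiff ℝ ∞ (kumanoGoSymbol φ ψ χ K b) := by
  have h1 : ContDiff ℝ ∞ fun p : Rn n × Rn n => φ p.1 * ψ p.2 :=
    (hφ.comp contDiff_fst).mul (hψ.comp contDiff_snd)
  refine ((contDiff_const.mul (Complex.ofRealCLM.contDiff.comp h1)).neg.cexp).mul
    (contDiff_prod fun j _ => (hχ.comp
      ((EuclideanSpace.proj (𝕜 := ℝ) j).contDiff.comp contDiff_fst)).mul ?_)
  rw [contDiff_iff_contDiffAt]
  intro p
  have hθ : ContDiff ℝ ∞ fun p : Rn n × Rn n => p.2 j :=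
    (EuclideanSpace.proj (𝕜 := ℝ) j).contDiff.comp contDiff_snd
  -- At x = 0 the norm and b need not be smooth, but K is evaluated close to 0, where it is
  -- identically 1.
  by_cases hp : p.1 = 0
  · have hcont : Continuous fun p : Rn n × Rn n => |b ‖p.1‖ * ‖p.1‖ * p.2 j| :=
      (hb.continuous_scaled j).abs
    have hev : ∀ᶠ q in 𝓝 p, |b ‖q.1‖ * ‖q.1‖ * q.2 j| < δ :=
      hcont.continuousAt.eventually_lt continuousAt_const (by simpa [hp] using hδ)
    refine (contDiffAt_const (c := (1 : ℂ))).congr_of_eventuallyEq ?_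
    filter_upwards [hev] with q hq
    exact hK _ ⟨(abs_lt.1 hq).1.le, (abs_lt.1 hq).2.le⟩
  · have hn : ContDiffAt ℝ ∞ (fun q : Rn n × Rn n => ‖q.1‖) p :=
      contDiff_fst.contDiffAt.norm ℝ hp
    have hbn : ContDiffAt ℝ ∞ (fun q : Rn n × Rn n => b ‖q.1‖) p :=
      ContDiffAt.comp (g := b) p
        (hb.smooth.contDiffAt (isOpen_Ioi.mem_nhds (mem_Ioi.2 (norm_pos_iff.2 hp)))) hn
    exact (K.smooth ⊤).contDiffAt.comp p ((hbn.mul hn).mul hθ.contDiffAt)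

theorem EuclideanSpace.norm_le_sum_abs (θ : Rn n) : ‖θ‖ ≤ ∑ j, |θ j| := by
  rw [EuclideanSpace.norm_eq]
  refine Real.sqrt_le_iff.2 ⟨by positivity, ?_⟩
  simpa using Finset.sum_sq_le_sq_sum_of_nonneg (s := Finset.univ) (f := fun j => |θ j|)
    fun j _ => abs_nonneg _

theorem one_add_mul_norm_le_prod {g : ℝ} (hg : 0 ≤ g) (θ : Rn n) :
    1 + g * ‖θ‖ ≤ ∏ j, (1 + |g * θ j|) := by
  have h : ∀ s : Finset (Fin n), 1 + ∑ j ∈ s, |g * θ j| ≤ ∏ j ∈ s, (1 + |g * θ j|) := by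
    intro s
    induction s using Finset.induction_on with
    | empty => simp
    | insert i s hi ih =>
      rw [Finset.sum_insert hi, Finset.prod_insert hi]
      have h1 := abs_nonneg (g * θ i)
      have h2 : 0 ≤ ∑ j ∈ s, |g * θ j| := Finset.sum_nonneg fun j _ => abs_nonneg _
      nlinarith
  refine le_trans ?_ (h Finset.univ)
  simp only [abs_mul, abs_of_nonneg hg, ← Finset.mul_sum]
  have := mul_le_mul_of_nonneg_left (EuclideanSpace.norm_le_sum_abs θ) hg
  linarith

/-- Replacing r by b(r)r costs 1 + |log r|. When r(1 + t) > 1 and r < R, this is at most a constant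
plus log(1 + t), hence O((1 + t)^(1 - ρ)). When r(1 + t) ≤ 1 the left side is already at most 2(1 +
t)⁻¹. -/
theorem exists_add_inv_le_rpow (hb : IsKumanoGo b)
    (hlog : ∀ t, 0 < t → 1 ≤ b t * (1 + |Real.log t|)) {ρ R : ℝ} (hρ : ρ < 1) (hR : 0 ≤ R) :
    ∃ C : ℝ, 0 < C ∧ ∀ r t : ℝ, 0 ≤ r → r < R → 0 ≤ t →
      r + (1 + t)⁻¹ ≤ C * (1 + t) ^ (-ρ) * (1 + b r * r * t) := by
  have hε : 0 < 1 - ρ := by linarith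
  set C₁ := 1 + R + (1 - ρ)⁻¹ with hC₁
  have hC₁0 : 0 < C₁ := by positivity
  refine ⟨R + 2 + C₁, by positivity, fun r t hr hrR ht => ?_⟩
  have hA : (0 : ℝ) < 1 + t := by positivity
  have hAε : 1 ≤ (1 + t) ^ (1 - ρ) := Real.one_le_rpow (by linarith) hε.le
  have hbr : 0 ≤ b r * r * t := mul_nonneg (mul_nonneg (hb.nonneg hr) hr) ht
  have key : r * (1 + t) + 1 ≤ (R + 2 + C₁) * (1 + t) ^ (1 - ρ) * (1 + b r * r * t) := by
    have h1 : 1 ≤ (1 + t) ^ (1 - ρ) * (1 + b r * r * t) := by nlinarith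
    rw [mul_assoc]
    rcases le_or_gt (r * (1 + t)) 1 with h | h
    · nlinarith
    · have hr0 : 0 < r := by
        rcases hr.eq_or_lt with rfl | h'
        · simp at h; linarith
        · exact h'
      have hl : |Real.log r| ≤ R + Real.log (1 + t) := by
        have hlA : 0 ≤ Real.log (1 + t) := Real.log_nonneg (by linarith)
        have h2 := Real.log_le_sub_one_of_pos hr0
        have h3 := Real.log_pos h
        rw [Real.log_mul hr0.ne' hA.ne'] at h3
        rw [abs_le]
        constructor <;> linarith
      have hlA : Real.log (1 + t) ≤ (1 + t) ^ (1 - ρ) * (1 - ρ)⁻¹ := by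
        simpa [div_eq_mul_inv] using Real.log_le_rpow_div hA.le hε
      have h4 : 1 + |Real.log r| ≤ C₁ * (1 + t) ^ (1 - ρ) := by
        rw [hC₁]
        nlinarith
      have h5 : r * t ≤ C₁ * (1 + t) ^ (1 - ρ) * (b r * r * t) := by
        have h6 : 1 ≤ b r * (C₁ * (1 + t) ^ (1 - ρ)) :=
          (hlog r hr0).trans (mul_le_mul_of_nonneg_left h4 (hb.nonneg hr))
        have := mul_le_mul_of_nonneg_left h6 (mul_nonneg hr ht)
        nlinarith
      have h7 : 0 ≤ (1 + t) ^ (1 - ρ) * (b r * r * t) := by positivity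
      nlinarith
  have hAρ : (1 + t) ^ (1 - ρ) = (1 + t) * (1 + t) ^ (-ρ) := by
    rw [sub_eq_add_neg, Real.rpow_add hA, Real.rpow_one]
  rw [hAρ] at key
  have h8 : (r + (1 + t)⁻¹) * (1 + t) = r * (1 + t) + 1 := by
    rw [add_mul, inv_mul_cancel₀ hA.ne']
  refine le_of_mul_le_mul_right ?_ hA
  rw [h8]
  linarith

theorem kumanoGoSymbol_mem_symbolClass (hb : IsKumanoGo b) {B : ℝ}
    (hB : ∀ t, 0 ≤ t → |b t| ≤ B) (hlog : ∀ t, 0 < t → 1 ≤ b t * (1 + |Real.log t|))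
    {φ ψ : Rn n → ℝ} (hφψ : IsSeparatedPhase φ ψ) (K : 𝓢(ℝ, ℂ)) {δ : ℝ}
    (hδ : 0 < δ) (hK : ∀ t ∈ Icc (-δ) δ, K t = 1) {χ : ℝ → ℂ} (hχ : ContDiff ℝ ∞ χ)
    (hsupp : tsupport χ ⊆ Icc (-1) 1) :
    kumanoGoSymbol φ ψ χ K b ∈ ⋂ ρ ∈ Ioo (0 : ℝ) 1, symbolClass n n 0 ρ 1 := by
  simp only [mem_iInter]
  intro ρ hρ
  refine ⟨contDiff_kumanoGoSymbol hb hφψ.smooth_left hφψ.smooth_right K hδ hK hχ, fun α γ => ?_⟩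
  obtain ⟨L, rfl⟩ := exists_clm_of_homogeneous
    (hφψ.smooth_right.differentiable (by simp) 0) hφψ.homogeneous
  obtain ⟨C₀, hC₀⟩ := hφψ.bound
  -- If |x| > n, some |xⱼ| exceeds 1 and the symbol vanishes; the radius n + 1 makes the open sets
  -- |x| < R and |x| > n cover everything.
  set R : ℝ := n + 1 with hR
  -- The decay exponent is |γ|: one factor (1 + g(x)|θ|)⁻¹ for each θ-derivative.
  have hin := HasSymBound.multiPartial (fun k => hasSymBound_kumanoGoSymbol hb hB
    hφψ.smooth_left hC₀ L K hδ hK hχ R (∑ j, γ j) k) α γ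
  have hΩ' : IsOpen {p : Rn n × Rn n | (n : ℝ) < ‖p.1‖} :=
    isOpen_lt continuous_const continuous_fst.norm
  have hout := HasSymBound.multiPartial (Ω := {p : Rn n × Rn n | (n : ℝ) < ‖p.1‖})
    (W := fun _ => 0) (a := kumanoGoSymbol φ L χ K b)
    (fun k => (HasDerivBound.zero (F := ℂ)).congr hΩ' fun p hp => by
      have hp : (n : ℝ) < ‖p.1‖ := hp
      obtain ⟨j, hj⟩ : ∃ j, 1 < |p.1 j| := by
        by_contra! h
        have h1 := (EuclideanSpace.norm_le_sum_abs p.1).trans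
          (Finset.sum_le_sum fun j _ => h j)
        simp at h1
        linarith
      have : χ (p.1 j) = 0 := by
        refine image_eq_zero_of_notMem_tsupport fun h => ?_
        exact absurd (abs_le.2 ⟨(hsupp h).1, (hsupp h).2⟩) (not_le.2 hj)
      simp only [kumanoGoSymbol]
      rw [Finset.prod_eq_zero (Finset.mem_univ j) (by simp [this]), mul_zero]) α γ
  obtain ⟨C₁, hC₁, hin⟩ := hin
  obtain ⟨C₂, hC₂, hout⟩ := hout
  obtain ⟨C₃, hC₃, hdec⟩ := exists_add_inv_le_rpow hb hlog (R := R) hρ.2 (by positivity)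
  set m := ∑ j, γ j with hm
  set l := ∑ i, α i with hl
  refine ⟨C₁ * C₃ ^ m + 1, by positivity, fun x θ => ?_⟩
  have hA : (0 : ℝ) < 1 + ‖θ‖ := by positivity
  have hexp : (1 + ‖θ‖) ^ (0 - ρ * (m : ℝ) + 1 * (l : ℝ)) =
      (1 + ‖θ‖) ^ l * ((1 + ‖θ‖) ^ (-ρ)) ^ m := by
    rw [← Real.rpow_natCast _ l, ← Real.rpow_natCast _ m, ← Real.rpow_mul hA.le,
      ← Real.rpow_add hA]
    congr 1
    ring
  rw [hexp]
  have hpos : 0 ≤ (1 + ‖θ‖) ^ l * ((1 + ‖θ‖) ^ (-ρ)) ^ m := by positivity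
  rcases lt_or_ge ‖x‖ R with hx | hx
  · refine (hin (x, θ) hx).trans ?_
    have hg : 0 ≤ b ‖x‖ * ‖x‖ := mul_nonneg (hb.nonneg (norm_nonneg _)) (norm_nonneg _)
    have h1 : ∏ j, ((1 + |b ‖x‖ * ‖x‖ * θ j|) ^ m)⁻¹ ≤ ((1 + b ‖x‖ * ‖x‖ * ‖θ‖) ^ m)⁻¹ := by
      rw [Finset.prod_inv_distrib, Finset.prod_pow]
      have := one_add_mul_norm_le_prod hg θ
      gcongr
    have h2 : (‖x‖ + (1 + ‖θ‖)⁻¹) ^ m ≤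
        (C₃ * (1 + ‖θ‖) ^ (-ρ) * (1 + b ‖x‖ * ‖x‖ * ‖θ‖)) ^ m := by
      gcongr
      exact hdec _ _ (norm_nonneg _) hx (norm_nonneg _)
    have h3 : (‖x‖ + (1 + ‖θ‖)⁻¹) ^ m * ∏ j, ((1 + |b ‖x‖ * ‖x‖ * θ j|) ^ m)⁻¹ ≤
        C₃ ^ m * ((1 + ‖θ‖) ^ (-ρ)) ^ m := by
      refine (mul_le_mul h2 h1 (by positivity) (by positivity)).trans (le_of_eq ?_)
      have : (1 + b ‖x‖ * ‖x‖ * ‖θ‖) ^ m ≠ 0 := by positivity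
      rw [mul_pow, mul_pow, mul_assoc, mul_inv_cancel₀ this, mul_one]
    calc C₁ * ((1 + ‖θ‖) ^ l * ((‖x‖ + (1 + ‖θ‖)⁻¹) ^ m *
          ∏ j, ((1 + |b ‖x‖ * ‖x‖ * θ j|) ^ m)⁻¹))
        ≤ C₁ * ((1 + ‖θ‖) ^ l * (C₃ ^ m * ((1 + ‖θ‖) ^ (-ρ)) ^ m)) := by gcongr
      _ ≤ (C₁ * C₃ ^ m + 1) * ((1 + ‖θ‖) ^ l * ((1 + ‖θ‖) ^ (-ρ)) ^ m) := by linarith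
  · refine (hout (x, θ) (show (n : ℝ) < ‖x‖ by linarith)).trans ?_
    simp only [mul_zero]
    positivity

end Symbol

/-! ### The function b and the scale g. -/

/-- The function `arctan (log t) + π / 2`, extended by zero. -/
def logArctan (t : ℝ) : ℝ := if 0 < t then Real.arctan (Real.log t) + Real.pi / 2 else 0

/-- With u = arctan(log t) one has du/dt = cos²(u)/t, so every derivative yields another t⁻¹ and a
smooth function of u. As u stays in a compact interval, the bounds C t⁻ᵏ follow. -/
theorem exists_iteratedDeriv_eq_comp_arctan_log {f p : ℝ → ℝ} (hp : ContDiff ℝ ∞ p)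
    (hf : EqOn f (fun t => p (Real.arctan (Real.log t))) (Ioi 0)) (k : ℕ) :
    ∃ q : ℝ → ℝ, ContDiff ℝ ∞ q ∧
      EqOn (iteratedDeriv k f) (fun t => (t ^ k)⁻¹ * q (Real.arctan (Real.log t))) (Ioi 0) := by
  induction k with
  | zero => exact ⟨p, hp, fun t ht => by simpa using hf ht⟩
  | succ k ih =>
    obtain ⟨q, hq, h⟩ := ih
    have hq' : ContDiff ℝ ∞ (deriv q) := by
      have := hq.iterate_deriv 1
      simpa using this
    refine ⟨fun u => -k * q u + deriv q u * Real.cos u ^ 2,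
      (contDiff_const.mul hq).add (hq'.mul (Real.contDiff_cos.pow 2)), fun t ht => ?_⟩
    have ht0 : (0 : ℝ) < t := ht
    have h1 : HasDerivAt (fun t : ℝ => (t ^ k)⁻¹) (-(k * t ^ (k - 1)) / (t ^ k) ^ 2) t :=
      (hasDerivAt_pow k t).inv (by positivity)
    have h2 := (((hq.differentiable (by simp)) _).hasDerivAt.comp t
      ((Real.hasDerivAt_log ht0.ne').arctan))
    have h0 : HasDerivAt (fun t => (t ^ k)⁻¹ * q (Real.arctan (Real.log t))) _ t := h1.mul h2
    rw [iteratedDeriv_succ,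
      (h.eventuallyEq_of_mem (isOpen_Ioi.mem_nhds ht)).deriv_eq, h0.deriv]
    simp only [Real.cos_sq_arctan]
    have hk : (k : ℝ) * t ^ (k - 1) * t = k * t ^ k := by
      cases k with
      | zero => simp
      | succ k => simp [pow_succ]; ring
    have h3 : -((k : ℝ) * t ^ (k - 1)) / (t ^ k) ^ 2 = -k * (t ^ (k + 1))⁻¹ := by
      field_simp
      linear_combination -(t ^ k) * hk
    rw [h3, pow_succ]
    have : (0 : ℝ) < 1 + Real.log t ^ 2 := by positivity
    field_simp

theorem contDiffOn_comp_arctan_log {f p : ℝ → ℝ} (hp : ContDiff ℝ ∞ p)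
    (hf : EqOn f (fun t => p (Real.arctan (Real.log t))) (Ioi 0)) : ContDiffOn ℝ ∞ f (Ioi 0) := by
  refine ContDiffOn.congr ?_ hf
  exact hp.comp_contDiffOn (Real.contDiff_arctan.comp_contDiffOn
    (Real.contDiffOn_log.mono fun t ht => ne_of_gt ht))

theorem logArctan_eqOn :
    EqOn logArctan (fun t => (fun u => u + Real.pi / 2) (Real.arctan (Real.log t))) (Ioi 0) :=
  fun t ht => by simp [logArctan, mem_Ioi.1 ht]

theorem abs_logArctan_le (t : ℝ) : |logArctan t| ≤ Real.pi := by
  have := Real.pi_pos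
  unfold logArctan
  split_ifs
  · rw [abs_le]
    constructor <;> linarith [Real.arctan_lt_pi_div_two (Real.log t),
      Real.neg_pi_div_two_lt_arctan (Real.log t)]
  · simpa using this.le

/-- From sin y ≤ y at y = arctan(log t) + π/2: the sine equals cos(arctan(log t)) = (1 + log²
t)^(-1/2). -/
theorem one_le_logArctan_mul {t : ℝ} (ht : 0 < t) :
    1 ≤ logArctan t * (1 + |Real.log t|) := by
  have h1 : Real.cos (Real.arctan (Real.log t)) ≤ logArctan t := by
    rw [logArctan, if_pos ht, ← Real.sin_add_pi_div_two]
    exact Real.sin_le (by linarith [Real.neg_pi_div_two_lt_arctan (Real.log t)])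
  rw [Real.cos_arctan] at h1
  have h2 : √(1 + Real.log t ^ 2) ≤ 1 + |Real.log t| := by
    refine Real.sqrt_le_iff.2 ⟨by positivity, ?_⟩
    have := abs_nonneg (Real.log t)
    nlinarith [sq_abs (Real.log t)]
  have h3 : 0 < √(1 + Real.log t ^ 2) := by positivity
  rw [div_le_iff₀ h3] at h1
  have h4 : 0 ≤ logArctan t := by
    by_contra! h
    nlinarith
  exact h1.trans (mul_le_mul_of_nonneg_left h2 h4)

theorem isKumanoGo_logArctan : IsKumanoGo logArctan := by
  have hp : ContDiff ℝ ∞ fun u : ℝ => u + Real.pi / 2 := contDiff_id.add contDiff_const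
  have hs := contDiffOn_comp_arctan_log hp logArctan_eqOn
  refine ⟨?_, hs, by simp [logArctan], fun t ht => ?_, fun k _ => ?_⟩
  · intro t ht
    rcases (mem_Ici.1 ht).eq_or_lt with rfl | ht
    · rw [← Ioi_insert, continuousWithinAt_insert_self]
      have h1 : Tendsto (fun t => Real.arctan (Real.log t) + Real.pi / 2) (𝓝[>] 0)
          (𝓝 (-(Real.pi / 2) + Real.pi / 2)) :=
        ((Real.tendsto_arctan_atBot.mono_right nhdsWithin_le_nhds).comp
          Real.tendsto_log_nhdsGT_zero).add_const _
      have h2 : logArctan 0 = 0 := by simp [logArctan]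
      rw [ContinuousWithinAt, h2]
      rw [neg_add_cancel] at h1
      refine h1.congr' ?_
      filter_upwards [self_mem_nhdsWithin] with t ht
      exact (logArctan_eqOn ht).symm
    · exact (hs.continuousOn.continuousAt (isOpen_Ioi.mem_nhds ht)).continuousWithinAt
  · rw [(logArctan_eqOn.eventuallyEq_of_mem (isOpen_Ioi.mem_nhds (mem_Ioi.2 ht))).deriv_eq,
      (((Real.hasDerivAt_log ht.ne').arctan).add_const (Real.pi / 2)).deriv]
    positivity
  · obtain ⟨q, hq, h⟩ := exists_iteratedDeriv_eq_comp_arctan_log hp logArctan_eqOn k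
    obtain ⟨C, hC⟩ := (isCompact_Icc (a := -(Real.pi / 2))
      (b := Real.pi / 2)).exists_bound_of_continuousOn hq.continuous.continuousOn
    refine ⟨|C| + 1, by positivity, fun t ht => ?_⟩
    rw [h (mem_Ioi.2 ht), abs_mul, abs_inv, abs_pow, abs_of_pos ht, mul_comm]
    have h1 := hC (Real.arctan (Real.log t))
      ⟨(Real.neg_pi_div_two_lt_arctan _).le, (Real.arctan_lt_pi_div_two _).le⟩
    rw [Real.norm_eq_abs] at h1
    gcongr
    linarith [le_abs_self C]

theorem IsKumanoGo.tendsto_zero {b : ℝ → ℝ} (hb : IsKumanoGo b) :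
    Tendsto b (𝓝[≥] 0) (𝓝 0) := by
  have := hb.continuousOn 0 self_mem_Ici
  rwa [ContinuousWithinAt, hb.zero] at this

theorem IsKumanoGo.isScale {n : ℕ} (hn : 1 ≤ n) {b : ℝ → ℝ} (hb : IsKumanoGo b) (β : ℝ) :
    IsScale β (fun x : Rn n => b ‖x‖ * ‖x‖) := by
  have hc : Continuous fun x : Rn n => b ‖x‖ :=
    hb.continuousOn.comp_continuous continuous_norm fun x => norm_nonneg x
  refine ⟨(hc.mul continuous_norm).continuousOn,
    fun x _ => mul_nonneg (hb.nonneg (norm_nonneg x)) (norm_nonneg x), ?_, ?_⟩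
  · have h1 : Tendsto (fun x : Rn n => b ‖x‖) (𝓝 0) (𝓝 0) := by
      simpa [hb.zero] using hc.tendsto 0
    refine (h1.mono_left nhdsWithin_le_nhds).congr' ?_
    filter_upwards [self_mem_nhdsWithin] with x hx
    have hx0 : x ≠ 0 := by
      rintro rfl
      simpa using (hx ⟨0, hn⟩).1
    rw [mul_div_assoc, div_self (norm_ne_zero_iff.2 hx0), mul_one]
  · intro i x y hx hy hxy hi
    have hlt : ‖x‖ < ‖y‖ := by
      rw [EuclideanSpace.norm_eq, EuclideanSpace.norm_eq]
      refine Real.sqrt_lt_sqrt (by positivity) (Finset.sum_lt_sum (fun j _ => ?_)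
        ⟨i, Finset.mem_univ i, ?_⟩)
      · rcases eq_or_ne j i with rfl | h
        · have := (hx j).1
          simp only [Real.norm_eq_abs, sq_abs]
          nlinarith
        · rw [hxy j h]
      · have := (hx i).1
        simp only [Real.norm_eq_abs, sq_abs]
        nlinarith
    have hbl := hb.strictMonoOn (norm_nonneg x) (norm_nonneg y) hlt
    exact mul_lt_mul'' hbl hlt (hb.nonneg (norm_nonneg x)) (norm_nonneg x)

/-! ### The Fourier transform in the normalization without 2π. -/

section FourierT

variable {V : Type*} [NormedAddCommGroup V] [InnerProductSpace ℝ V] [MeasurableSpace V]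
  [BorelSpace V] [FiniteDimensional ℝ V]

theorem fourierT_eq_fourierIntegral (u : V → ℂ) (θ : V) :
    fourierT u θ = VectorFourier.fourierIntegral Real.probChar volume (innerₗ V) u θ := by
  rw [VectorFourier.fourierIntegral_probChar, fourierT]
  refine integral_congr_ae (ae_of_all _ fun y => ?_)
  simp [mul_comm]

theorem integral_mul_fourierT {u w : V → ℂ} (hu : Integrable u) (hw : Integrable w) :
    ∫ θ, w θ * fourierT u θ = ∫ y, u y * fourierT w y := by
  have h := VectorFourier.integral_fourierIntegral_smul_eq_flip (L := innerₗ V)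
    (μ := (volume : Measure V)) (ν := (volume : Measure V))
    Real.continuous_probChar continuous_inner hu hw
  simp only [flip_innerₗ, ← fourierT_eq_fourierIntegral, smul_eq_mul] at h
  simpa only [mul_comm] using h

open scoped FourierTransform in
theorem fourierT_eq_fourier (u : V → ℂ) (θ : V) : fourierT u θ = 𝓕 u ((2 * Real.pi)⁻¹ • θ) := by
  rw [Real.fourier_eq', fourierT]
  refine integral_congr_ae (ae_of_all _ fun y => ?_)
  have : (Real.pi : ℂ) ≠ 0 := by exact_mod_cast Real.pi_ne_zero
  simp only [smul_eq_mul, inner_smul_right]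
  congr 2
  push_cast
  field_simp

end FourierT

open scoped FourierTransform in
theorem SchwartzMap.fourierT_eq (K : 𝓢(ℝ, ℂ)) (t : ℝ) :
    fourierT K t = (𝓕 K) ((2 * Real.pi)⁻¹ • t) := by
  rw [fourierT_eq_fourier, SchwartzMap.fourier_coe]

theorem SchwartzMap.integrable_fourierT (K : 𝓢(ℝ, ℂ)) : Integrable (fourierT K) := by
  have h : fourierT (K : ℝ → ℂ) = _ := funext fun t => K.fourierT_eq t
  rw [h]
  exact (SchwartzMap.integrable _).comp_smul (by positivity)

open scoped FourierTransform in
-- Fourier inversion at 0; the factor 2π is the Jacobian of the change of normalization.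
theorem SchwartzMap.integral_fourierT (K : 𝓢(ℝ, ℂ)) :
    ∫ t, fourierT K t = 2 * Real.pi * K 0 := by
  have h1 : ∫ t, (𝓕 K) t = K 0 := by
    have : 𝓕⁻ (𝓕 K) = K := FourierTransform.fourierInv_fourier_eq K
    have h2 := congrArg (fun f : 𝓢(ℝ, ℂ) => f 0) this
    simp only [SchwartzMap.fourierInv_coe, Real.fourierInv_eq'] at h2
    simpa using h2
  simp_rw [K.fourierT_eq]
  rw [Measure.integral_comp_inv_smul, h1]
  simp [abs_of_pos Real.pi_pos]

/-! ### Products over coordinates, and cubes. -/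

section Product

variable {n : ℕ}

theorem integral_prod_coord (f : Fin n → ℝ → ℂ) :
    ∫ x : Rn n, ∏ j, f j (x j) = ∏ j, ∫ t, f j t := by
  rw [← integral_fintype_prod_volume_eq_prod]
  exact (EuclideanSpace.volume_preserving_symm_measurableEquiv_toLp (Fin n)).integral_comp'
    (fun x : Fin n → ℝ => ∏ j, f j (x j))

theorem integrable_prod_coord {f : Fin n → ℝ → ℂ} (hf : ∀ j, Integrable (f j)) :
    Integrable fun x : Rn n => ∏ j, f j (x j) :=
  ((EuclideanSpace.volume_preserving_symm_measurableEquiv_toLp (Fin n)).integrable_comp_emb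
    (MeasurableEquiv.measurableEmbedding _)).2 (Integrable.fintype_prod hf)

theorem fourierT_prod_scaled (f : ℝ → ℂ) {s : ℝ} (hs : 0 < s) (y : Rn n) :
    fourierT (fun θ : Rn n => ∏ j, f (s * θ j)) y = (s⁻¹ : ℂ) ^ n * ∏ j, fourierT f (s⁻¹ * y j) := by
  have h1 : ∀ θ : Rn n, Complex.exp (-(Complex.I * ((⟪θ, y⟫_ℝ : ℝ) : ℂ))) * ∏ j, f (s * θ j) =
      ∏ j, (Complex.exp (-(Complex.I * ((⟪θ j, y j⟫_ℝ : ℝ) : ℂ))) * f (s * θ j)) := by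
    intro θ
    rw [Finset.prod_mul_distrib, ← Complex.exp_sum, PiLp.inner_apply]
    push_cast
    rw [Finset.sum_neg_distrib, Finset.mul_sum]
  have h2 : ∀ t : ℝ, ∫ r : ℝ, Complex.exp (-(Complex.I * ((⟪r, t⟫_ℝ : ℝ) : ℂ))) * f (s * r) =
      (s⁻¹ : ℂ) * fourierT f (s⁻¹ * t) := by
    intro t
    have h := Measure.integral_comp_smul (volume : Measure ℝ)
      (fun r : ℝ => Complex.exp (-(Complex.I * ((⟪r, s⁻¹ * t⟫_ℝ : ℝ) : ℂ))) * f r) s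
    simp only [Module.finrank_self, pow_one, abs_inv, abs_of_pos hs, smul_eq_mul] at h
    rw [fourierT]
    refine Eq.trans (integral_congr_ae (ae_of_all _ fun r => ?_))
      (h.trans (by rw [Complex.real_smul, Complex.ofReal_inv]))
    have : ⟪s * r, s⁻¹ * t⟫_ℝ = ⟪r, t⟫_ℝ := by
      simp only [RCLike.inner_apply, conj_trivial]
      field_simp
    simp only [this]
  rw [fourierT]
  simp_rw [h1]
  rw [integral_prod_coord (fun j r => Complex.exp (-(Complex.I * ((⟪r, y j⟫_ℝ : ℝ) : ℂ))) *
    f (s * r))]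
  simp_rw [h2, Finset.prod_mul_distrib]
  simp

/-- The multiplication formula moves the transform onto the product, and y = sz absorbs the Jacobian
s⁻ⁿ. -/
theorem integral_prod_scaled_mul_fourierT (u : 𝓢(Rn n, ℂ)) (K : 𝓢(ℝ, ℂ)) {s : ℝ} (hs : 0 < s) :
    ∫ θ : Rn n, (∏ j, K (s * θ j)) * fourierT u θ =
      ∫ z : Rn n, u (s • z) * ∏ j, fourierT K (z j) := by
  rw [integral_mul_fourierT u.integrable
    (integrable_prod_coord fun j => (K.integrable.comp_mul_left' hs.ne'))]
  have h := Measure.integral_comp_smul_of_nonneg (volume : Measure (Rn n))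
    (fun y : Rn n => u y * ∏ j, fourierT K (s⁻¹ * y j)) s (hR := hs.le)
  have h1 : ∀ z : Rn n, (fun y : Rn n => u y * ∏ j, fourierT K (s⁻¹ * y j)) (s • z) =
      u (s • z) * ∏ j, fourierT K (z j) := by
    intro z
    simp [inv_mul_cancel_left₀ hs.ne']
  simp_rw [h1] at h
  rw [h, ← integral_smul]
  refine integral_congr_ae (ae_of_all _ fun y => ?_)
  simp only [fourierT_prod_scaled K hs y, finrank_euclideanSpace, Fintype.card_fin,
    Complex.real_smul]
  push_cast
  ring

theorem norm_le_sum_of_mem_cube {a : ℝ} {x : Rn n} (hx : ∀ i, x i ∈ Ioo 0 a) : ‖x‖ ≤ n * a := by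
  refine (EuclideanSpace.norm_le_sum_abs x).trans ?_
  refine (Finset.sum_le_sum fun i _ => (abs_of_pos (hx i).1).le.trans (hx i).2.le).trans ?_
  simp

theorem volume_cube (a : ℝ) :
    volume {x : Rn n | ∀ i, x i ∈ Ioo 0 a} = ENNReal.ofReal a ^ n := by
  have h := (EuclideanSpace.volume_preserving_symm_measurableEquiv_toLp (Fin n)).measure_preimage_equiv
    (Set.pi univ fun _ => Ioo 0 a)
  rw [Real.volume_pi_Ioo] at h
  simp only [sub_zero, Finset.prod_const, Finset.card_univ, Fintype.card_fin] at h
  rw [← h]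
  congr 1
  ext x
  simp [MeasurableEquiv.coe_toLp_symm]

theorem measurableSet_cube (a : ℝ) : MeasurableSet {x : Rn n | ∀ i, x i ∈ Ioo 0 a} := by
  have : {x : Rn n | ∀ i, x i ∈ Ioo 0 a} = ⋂ i, {x : Rn n | x i ∈ Ioo 0 a} := by
    ext; simp
  rw [this]
  exact MeasurableSet.iInter fun i => measurableSet_Ioo.preimage
    (EuclideanSpace.proj (𝕜 := ℝ) i).continuous.measurable

end Product

/-! ### The averaging formula and the failure of L² boundedness. -/

section Operator

variable {n : ℕ} {b : ℝ → ℝ}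

theorem norm_pos_of_forall_coord_pos (hn : 1 ≤ n) {x : Rn n} (hx : ∀ i, 0 < x i) : 0 < ‖x‖ := by
  refine norm_pos_iff.2 ?_
  rintro rfl
  simpa using hx ⟨0, hn⟩

theorem fourierIntegralOp_kumanoGoSymbol (hn : 1 ≤ n) (hb : IsKumanoGo b) (φ ψ : Rn n → ℝ)
    (K : 𝓢(ℝ, ℂ)) {χ : ℝ → ℂ} {β : ℝ} (hχ : ∀ s ∈ Icc (-β) β, χ s = 1) (u : 𝓢(Rn n, ℂ))
    {x : Rn n} (hx : ∀ i, x i ∈ Ioc 0 β) :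
    fourierIntegralOp φ ψ (kumanoGoSymbol φ ψ χ K b) u x =
      ∫ z : Rn n, u ((b ‖x‖ * ‖x‖) • z) * ∏ j, fourierT K (z j) := by
  have hx0 : 0 < ‖x‖ := norm_pos_of_forall_coord_pos hn fun i => (hx i).1
  rw [← integral_prod_scaled_mul_fourierT u K (mul_pos (hb.pos hx0) hx0), fourierIntegralOp]
  refine integral_congr_ae (ae_of_all _ fun θ => ?_)
  have h1 : ∀ j, χ (x j) = 1 := fun j =>
    hχ _ ⟨by linarith [(hx j).1, (hx j).2], (hx j).2⟩
  simp only [kumanoGoSymbol, h1, one_mul]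
  rw [← mul_assoc, ← Complex.exp_add, add_neg_cancel, Complex.exp_zero, one_mul]

/-- Dominated convergence as the scale shrinks: u is bounded and the kernel integrable, with total
mass (2πK(0))ⁿ. -/
theorem tendsto_integral_scaled_mul_fourierT (u : 𝓢(Rn n, ℂ)) (K : 𝓢(ℝ, ℂ)) :
    Tendsto (fun s : ℝ => ∫ z : Rn n, u (s • z) * ∏ j, fourierT K (z j)) (𝓝 0)
      (𝓝 (u 0 * (2 * Real.pi * K 0) ^ n)) := by
  have hint : Integrable fun z : Rn n => ∏ j, fourierT K (z j) :=
    integrable_prod_coord fun _ => K.integrable_fourierT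
  obtain ⟨C, hC⟩ := u.decay 0 0
  have h := tendsto_integral_filter_of_dominated_convergence (μ := (volume : Measure (Rn n)))
    (l := 𝓝 (0 : ℝ)) (F := fun s z => u (s • z) * ∏ j, fourierT K (z j))
    (f := fun z => u 0 * ∏ j, fourierT K (z j))
    (fun z => C * ‖∏ j, fourierT K (z j)‖)
    (Eventually.of_forall fun s =>
      (u.continuous.comp (continuous_const_smul s)).aestronglyMeasurable.mul
        hint.aestronglyMeasurable)
    (Eventually.of_forall fun s => ae_of_all _ fun z => by
      rw [norm_mul]
      exact mul_le_mul_of_nonneg_right (by simpa using hC.2 (s • z)) (norm_nonneg _))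
    (hint.norm.const_mul C)
    (ae_of_all _ fun z => by
      have hc : Continuous fun s : ℝ => u (s • z) * ∏ j, fourierT K (z j) :=
        (u.continuous.comp (continuous_id.smul continuous_const)).mul continuous_const
      simpa using hc.tendsto 0)
  rw [integral_const_mul, integral_prod_coord fun _ => fourierT K] at h
  simpa [K.integral_fourierT] using h

theorem exists_smooth_bump (V : Type*) [NormedAddCommGroup V] [InnerProductSpace ℝ V]
    [FiniteDimensional ℝ V] :
    ∃ f : V → ℂ, ContDiff ℝ ∞ f ∧ (∀ x, ‖x‖ ≤ 1 / 2 → f x = 1) ∧ (∀ x, ‖f x‖ ≤ 1) ∧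
      ∀ x, 1 ≤ ‖x‖ → f x = 0 := by
  let g : ContDiffBump (0 : V) := ⟨1 / 2, 1, by norm_num, by norm_num⟩
  refine ⟨fun x => (g x : ℂ), Complex.ofRealCLM.contDiff.comp g.contDiff, fun x hx => ?_,
    fun x => ?_, fun x hx => ?_⟩
  · have : g x = 1 := g.one_of_mem_closedBall (mem_closedBall_zero_iff.2 hx)
    simp [this]
  · rw [Complex.norm_real, Real.norm_eq_abs, abs_of_nonneg g.nonneg]
    exact g.le_one
  · have : g x = 0 := g.zero_of_le_dist (by rw [dist_zero_right]; exact hx)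
    simp [this]

/-- A rescaled bump function `f(x / ε)` is a Schwartz function. -/
theorem exists_schwartz_rescaled {f : Rn n → ℂ} (hf : ContDiff ℝ ∞ f)
    (h0 : ∀ x, 1 ≤ ‖x‖ → f x = 0) {ε : ℝ} (hε : 0 < ε) :
    ∃ u : 𝓢(Rn n, ℂ), ∀ x, u x = f (ε⁻¹ • x) := by
  have hs : HasCompactSupport fun x => f (ε⁻¹ • x) := by
    refine HasCompactSupport.intro (isCompact_closedBall 0 ε) fun x hx => h0 _ ?_
    rw [mem_closedBall_zero_iff, not_le] at hx
    rw [norm_smul, norm_inv, Real.norm_eq_abs, abs_of_pos hε, inv_mul_eq_div, one_le_div hε]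
    exact hx.le
  exact ⟨hs.toSchwartzMap (hf.comp (contDiff_const_smul ε⁻¹)), fun x => rfl⟩

theorem eLpNorm_rescaled_le {f : Rn n → ℂ} (h1 : ∀ x, ‖f x‖ ≤ 1)
    (h0 : ∀ x, 1 ≤ ‖x‖ → f x = 0) {ε : ℝ} (hε : 0 < ε) :
    eLpNorm (fun x => f (ε⁻¹ • x)) 2 volume ≤
      (ENNReal.ofReal ε ^ n * volume (Metric.closedBall (0 : Rn n) 1)) ^ (1 / (2 : ℝ)) := by
  have h2 : eLpNorm (fun x => f (ε⁻¹ • x)) 2 volume ≤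
      eLpNorm ((Metric.closedBall (0 : Rn n) ε).indicator fun _ => (1 : ℝ)) 2 volume := by
    refine eLpNorm_mono fun x => ?_
    by_cases hx : x ∈ Metric.closedBall (0 : Rn n) ε
    · simpa [indicator_of_mem hx] using h1 (ε⁻¹ • x)
    · rw [h0 (ε⁻¹ • x)]
      · simp
      · rw [mem_closedBall_zero_iff, not_le] at hx
        rw [norm_smul, norm_inv, Real.norm_eq_abs, abs_of_pos hε, inv_mul_eq_div, one_le_div hε]
        exact hx.le
  refine h2.trans (le_of_eq ?_)
  rw [eLpNorm_indicator_const Metric.isClosed_closedBall.measurableSet (by simp) (by simp),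
    Measure.addHaar_closedBall' _ _ hε.le, ENNReal.ofReal_pow hε.le]
  simp

theorem not_extendsBoundedlyToL2_kumanoGoSymbol (hn : 1 ≤ n) (hb : IsKumanoGo b)
    (φ ψ : Rn n → ℝ) (K : 𝓢(ℝ, ℂ)) (hK : K 0 = 1) {χ : ℝ → ℂ} {β : ℝ} (hβ : 0 < β)
    (hχ : ∀ s ∈ Icc (-β) β, χ s = 1) :
    ¬ ExtendsBoundedlyToL2 (fourierIntegralOp φ ψ (kumanoGoSymbol φ ψ χ K b)) := by
  rintro ⟨C, hC⟩
  obtain ⟨f, hf, hf1, hfb, hf0⟩ := exists_smooth_bump (Rn n)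
  obtain ⟨u, hu⟩ := exists_schwartz_rescaled hf hf0 one_pos
  have hlim := tendsto_integral_scaled_mul_fourierT u K
  have hval : u 0 * (2 * Real.pi * K 0) ^ n = ((2 * Real.pi : ℝ) : ℂ) ^ n := by
    rw [hu, smul_zero, hf1 0 (by simp), hK]
    push_cast
    ring
  rw [hval] at hlim
  -- Half the modulus of the limit, so that |Fw| ≥ c persists at all sufficiently small scales.
  set c : ℝ := (2 * Real.pi) ^ n / 2 with hc
  have hc0 : 0 < c := by positivity
  have hev := hlim.norm.eventually (lt_mem_nhds (a := c) (by
    rw [norm_pow, Complex.norm_real, Real.norm_eq_abs, abs_of_pos Real.two_pi_pos, hc]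
    have : (0 : ℝ) < (2 * Real.pi) ^ n := by positivity
    linarith))
  obtain ⟨s₀, hs₀, hball⟩ := Metric.eventually_nhds_iff.1 hev
  set v : ℝ := (volume (Metric.closedBall (0 : Rn n) 1)).toReal with hv
  have hvt : volume (Metric.closedBall (0 : Rn n) 1) ≠ ⊤ := measure_closedBall_lt_top.ne
  have key : ∀ M : ℝ, 0 < M → c ^ 2 * M ^ n ≤ (C : ℝ) ^ 2 * v := by
    intro M hM
    have h1 : Tendsto (fun ε : ℝ => b (n * (M * ε)) * (n * M)) (𝓝[>] 0) (𝓝 0) := by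
      have h2 : Tendsto (fun ε : ℝ => (n : ℝ) * (M * ε)) (𝓝[>] 0) (𝓝[≥] 0) := by
        refine tendsto_nhdsWithin_iff.2 ⟨?_, ?_⟩
        · have : Continuous fun ε : ℝ => (n : ℝ) * (M * ε) := by fun_prop
          simpa using (this.tendsto 0).mono_left nhdsWithin_le_nhds
        · filter_upwards [self_mem_nhdsWithin] with ε hε
          have : (0 : ℝ) < ε := hε
          exact mem_Ici.2 (by positivity)
      simpa using (hb.tendsto_zero.comp h2).mul_const ((n : ℝ) * M)
    have h2 : Tendsto (fun ε : ℝ => M * ε) (𝓝[>] 0) (𝓝 0) := by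
      have : Continuous fun ε : ℝ => M * ε := by fun_prop
      simpa using (this.tendsto 0).mono_left nhdsWithin_le_nhds
    -- For fixed M, ε is small enough that the cube of side Mε lies where χ = 1, and that g(x)/ε ≤
    -- b(nMε)nM < s₀ on it.
    obtain ⟨ε, ⟨hεs, hεβ⟩, hε⟩ := (((h1.eventually (gt_mem_nhds hs₀)).and
      (h2.eventually (gt_mem_nhds hβ))).and self_mem_nhdsWithin).exists
    have hε : 0 < ε := hε
    obtain ⟨w, hw⟩ := exists_schwartz_rescaled hf hf0 hε
    have hlow : ∀ x : Rn n, (∀ i, x i ∈ Ioo 0 (M * ε)) →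
        c ≤ ‖fourierIntegralOp φ ψ (kumanoGoSymbol φ ψ χ K b) w x‖ := by
      intro x hx
      rw [fourierIntegralOp_kumanoGoSymbol hn hb φ ψ K hχ w
        fun i => ⟨(hx i).1, ((hx i).2.trans hεβ).le⟩]
      have h3 : ∀ z : Rn n, w ((b ‖x‖ * ‖x‖) • z) = u ((b ‖x‖ * ‖x‖ / ε) • z) := by
        intro z
        rw [hw, hu, inv_one, one_smul, smul_smul, div_eq_inv_mul]
      simp_rw [h3]
      refine (hball ?_).le
      have hx0 := norm_nonneg x
      have hxn := norm_le_sum_of_mem_cube hx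
      have hbx := hb.nonneg hx0
      rw [Real.dist_eq, sub_zero, abs_of_nonneg (by positivity), div_lt_iff₀ hε]
      have hbm : b ‖x‖ ≤ b (n * (M * ε)) :=
        hb.strictMonoOn.monotoneOn hx0 (mem_Ici.2 (hx0.trans hxn)) hxn
      calc b ‖x‖ * ‖x‖ ≤ b (n * (M * ε)) * (n * (M * ε)) :=
            mul_le_mul hbm hxn hx0 (hbx.trans hbm)
        _ = b (n * (M * ε)) * (n * M) * ε := by ring
        _ < s₀ * ε := mul_lt_mul_of_pos_right hεs hε
    have hL : ENNReal.ofReal c * (ENNReal.ofReal (M * ε) ^ n) ^ (1 / (2 : ℝ)) ≤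
        eLpNorm (fourierIntegralOp φ ψ (kumanoGoSymbol φ ψ χ K b) w) 2 volume := by
      have h3 := eLpNorm_indicator_const (μ := (volume : Measure (Rn n))) (c := c)
        (measurableSet_cube (M * ε)) (p := 2) (by simp) (by simp)
      rw [volume_cube, Real.enorm_eq_ofReal hc0.le] at h3
      simp only [ENNReal.toReal_ofNat] at h3
      rw [← h3]
      refine eLpNorm_mono fun x => ?_
      by_cases hx : x ∈ {x : Rn n | ∀ i, x i ∈ Ioo 0 (M * ε)}
      · rw [indicator_of_mem hx, Real.norm_eq_abs, abs_of_pos hc0]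
        exact hlow x hx
      · rw [indicator_of_notMem hx, norm_zero]
        exact norm_nonneg _
    have hU := eLpNorm_rescaled_le hfb hf0 hε
    have hwf : (w : Rn n → ℂ) = fun x => f (ε⁻¹ • x) := funext hw
    rw [← hwf] at hU
    have h4 := hL.trans ((hC w).trans (mul_le_mul_right hU (C : ENNReal)))
    have h5 := pow_le_pow_left₀ zero_le h4 2
    have hsq : ∀ y : ENNReal, (y ^ (1 / (2 : ℝ))) ^ 2 = y := by
      intro y
      rw [← ENNReal.rpow_natCast, ← ENNReal.rpow_mul]
      norm_num
    rw [mul_pow, mul_pow, hsq, hsq] at h5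
    have h6 := ENNReal.toReal_mono (by finiteness) h5
    simp only [ENNReal.toReal_mul, ENNReal.toReal_pow, ENNReal.toReal_ofReal hc0.le,
      ENNReal.toReal_ofReal hε.le, ENNReal.toReal_ofReal (mul_pos hM hε).le,
      ENNReal.coe_toReal, mul_pow] at h6
    have hεn : 0 < ε ^ n := by positivity
    refine le_of_mul_le_mul_right ?_ hεn
    calc c ^ 2 * M ^ n * ε ^ n = c ^ 2 * (M ^ n * ε ^ n) := by ring
      _ ≤ _ := h6
      _ = _ := by ring
  -- Using M + 1 keeps the base at least 1, so (M + 1)ⁿ ≥ M + 1 > M for n ≥ 1.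
  obtain ⟨M, hM⟩ := exists_nat_gt ((C : ℝ) ^ 2 * v / c ^ 2)
  rw [div_lt_iff₀ (by positivity)] at hM
  have h1 := key (M + 1) (by positivity)
  have h2 : (M : ℝ) + 1 ≤ ((M : ℝ) + 1) ^ n :=
    le_self_pow₀ (by linarith [M.cast_nonneg (α := ℝ)]) (by omega)
  have h3 : c ^ 2 * M < c ^ 2 * ((M : ℝ) + 1) ^ n :=
    mul_lt_mul_of_pos_left (by linarith) (by positivity)
  linarith

end Operator

theorem isSeparatedPhase_coord {n : ℕ} (i : Fin n) :
    IsSeparatedPhase (fun x : Rn n => x i) (fun θ : Rn n => θ i) where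
  smooth_left := (EuclideanSpace.proj (𝕜 := ℝ) i).contDiff
  smooth_right := (EuclideanSpace.proj (𝕜 := ℝ) i).contDiff
  homogeneous t θ _ := by simp
  bound := ⟨1, fun x _ => by simpa using PiLp.norm_apply_le x i⟩

end

theorem mainTheorem1 (n : ℕ) (hn : 1 ≤ n) :
    -- there is an unbounded Fourier integral operator with a symbol in all the classes
    (∃ (φ ψ : Rn n → ℝ) (a : Rn n × Rn n → ℂ),
      IsSeparatedPhase φ ψ ∧ (∀ x, fderiv ℝ φ x ≠ 0) ∧ (∃ θ, ψ θ ≠ 0) ∧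
      a ∈ ⋂ ρ ∈ Ioo (0 : ℝ) 1, symbolClass n n 0 ρ 1 ∧
      ¬ ExtendsBoundedlyToL2 (fourierIntegralOp φ ψ a)) ∧
    -- in fact one function `b` produces such a symbol for every separated phase
    (∃ b : ℝ → ℝ, IsKumanoGo b ∧
      ∀ (φ ψ : Rn n → ℝ), IsSeparatedPhase φ ψ →
      ∀ (K : 𝓢(ℝ, ℂ)) (δ : ℝ), 0 < δ → δ < 1 → (∀ t ∈ Icc (-δ) δ, K t = 1) →
      ∀ (χ : ℝ → ℂ) (β : ℝ), 0 < β → β < 1 → ContDiff ℝ ∞ χ → tsupport χ ⊆ Icc (-1) 1 →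
        (∀ s ∈ Icc (-β) β, χ s = 1) →
        kumanoGoSymbol φ ψ χ K b ∈ ⋂ ρ ∈ Ioo (0 : ℝ) 1, symbolClass n n 0 ρ 1 ∧
        IsScale β (fun x : Rn n => b ‖x‖ * ‖x‖) ∧
        (∀ (u : 𝓢(Rn n, ℂ)) (x : Rn n), (∀ i, x i ∈ Ioc 0 β) →
          fourierIntegralOp φ ψ (kumanoGoSymbol φ ψ χ K b) u x =
            ∫ z : Rn n, u ((b ‖x‖ * ‖x‖) • z) * ∏ j, fourierT K (z j)) ∧
        ¬ ExtendsBoundedlyToL2 (fourierIntegralOp φ ψ (kumanoGoSymbol φ ψ χ K b))) := by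
  have hb := isKumanoGo_logArctan
  refine ⟨?_, logArctan, hb, ?_⟩
  · obtain ⟨f, hf, hf1, -, hf0⟩ := exists_smooth_bump ℝ
    have hone : ∀ t ∈ Icc (-(1 / 2) : ℝ) (1 / 2), f t = 1 := fun t ht =>
      hf1 t (by rw [Real.norm_eq_abs, abs_le]; exact ht)
    have hsupp : tsupport f ⊆ Icc (-1) 1 := by
      refine closure_minimal (fun t ht => ?_) isClosed_Icc
      by_contra h
      refine ht (hf0 t ?_)
      rw [mem_Icc, ← abs_le, not_le] at h
      exact h.le
    have hcs : HasCompactSupport f :=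
      isCompact_Icc.of_isClosed_subset (isClosed_tsupport f) hsupp
    let i : Fin n := ⟨0, hn⟩
    -- For (1) the phase is x₁θ₁, and a single bump function serves as both χ and K, with β = δ =
    -- 1/2.
    refine ⟨fun x => x i, fun θ => θ i, kumanoGoSymbol (fun x => x i) (fun θ => θ i) f
      (hcs.toSchwartzMap hf) logArctan, isSeparatedPhase_coord i, fun x h => ?_,
      ⟨EuclideanSpace.single i 1, by simp⟩,
      kumanoGoSymbol_mem_symbolClass hb (fun t _ => abs_logArctan_le t)
        (fun t ht => one_le_logArctan_mul ht) (isSeparatedPhase_coord i) (hcs.toSchwartzMap hf)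
        (δ := 1 / 2) (by norm_num) hone hf hsupp,
      not_extendsBoundedlyToL2_kumanoGoSymbol hn hb _ _ (hcs.toSchwartzMap hf)
        (hone 0 (by norm_num)) (β := 1 / 2) (by norm_num) hone⟩
    have hd : HasFDerivAt (fun x : Rn n => x i) (EuclideanSpace.proj (𝕜 := ℝ) i) x :=
      (EuclideanSpace.proj (𝕜 := ℝ) i).hasFDerivAt
    rw [hd.fderiv] at h
    have := congrArg (fun L : Rn n →L[ℝ] ℝ => L (EuclideanSpace.single i 1)) h
    simp at this
  · intro φ ψ hφψ K δ hδ _ hK χ β hβ _ hχ hsupp hone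
    exact ⟨kumanoGoSymbol_mem_symbolClass hb (fun t _ => abs_logArctan_le t)
        (fun t ht => one_le_logArctan_mul ht) hφψ K hδ hK hχ hsupp,
      hb.isScale hn β,
      fun u x hx => fourierIntegralOp_kumanoGoSymbol hn hb φ ψ K hone u hx,
      not_extendsBoundedlyToL2_kumanoGoSymbol hn hb φ ψ K
        (hK 0 ⟨by linarith, hδ.le⟩) hβ hone⟩
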